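/- All graphs are finite, simple, connected and non-empty (call such a graph a network), simplicial complexes are connected and may be infinite. A port numbering $\delta$ of a network $G$ assigns to each vertex $v$ and each neighbour $w$ of $v$ a number $\delta_v(w)\in\mathbb N$, with $\delta_v$ injective on the neighbours of $v$. The binoculars label of $v$ is the isomorphism class of the subgraph induced by $v$ and its neighbours, rooted at $v$ and endowed with its port numbers. A mobile agent is a deterministic machine with unbounded memory and a computable transition function (a Turing machine). At each step it gets the binoculars label of its location and the port number, at that location, by which it last arrived there; from these and its memory it updates its memory and leaves by a port, stays, or halts. Vertices have no identities. A step that names a port number not in use at the current location leaves the agent where it is. An Exploration algorithm is an agent $\mathcal A$ such that on every network, for every port numbering and every starting vertex, either $\mathcal A$ visits every vertex and halts, or $\mathcal A$ never halts. A set $\mathcal F$ of networks is explorable if there is one Exploration algorithm that halts on every $G\in\mathcal F$, for every port numbering of $G$ and from every starting vertex; a network $G$ is explorable if $\{G\}$ is. A simplicial covering $\varphi:K\to K'$ is a simplicial map which, for every vertex $v$, restricts to a bijection from the star of $v$ (the simplices containing $v$ and their subsimplices) onto the star of $\varphi(v)$. The universal cover of a complex $K$ is a complex $\widehat K$ with a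 simplicial covering $\mu:\widehat K\to K$ such that for every simplicial covering $\varphi:K'\to K$ there is a simplicial covering $\gamma:\widehat K\to K'$ with $\varphi\circ\gamma=\mu$. Let $\mathrm{FNT}$ be the set of networks $G$ such that the universal cover of the clique complex of $G$ is finite. Theorem. $\mathrm{FNT}$ is the maximum set of explorable networks: $\mathrm{FNT}$ is explorable, and every explorable set of networks is contained in $\mathrm{FNT}$. In particular, a network is explorable if and only if it lies in $\mathrm{FNT}$. Moreover, for every network $G$ and every fixed port numbering $\delta$ of $G$, there is an Exploration algorithm that halts on $(G,\delta)$ from every starting vertex if and only if $G\in\mathrm{FNT}$. -/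

import Mathlib

namespace Binoculars

/-! ### Networks, port numberings and the binoculars labelling -/

/-- A network: a finite connected (hence non-empty) simple graph. -/
structure Network where
  V : Type
  finite : Finite V
  graph : SimpleGraph V
  connected : graph.Connected

/-- A port numbering: `port v w` is the number, at `v`, of the edge from `v` to its neighbour `w`.
Distinct neighbours of `v` get distinct numbers (values at non-neighbours are never used). -/
structure PortNumbering (N : Network) where
  port : N.V → N.V → ℕ
  injOn : ∀ v, Set.InjOn (port v) (N.graph.neighborSet v)

section Labelling

variable {N : Network} (δ : PortNumbering N)

open Classical in
/-- The neighbour of `v` to which port `p` leads, if there is one. -/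
noncomputable def neighborAt (v : N.V) (p : ℕ) : Option N.V :=
  if h : ∃ w, N.graph.Adj v w ∧ δ.port v w = p then some h.choose else none

open Classical in
/-- The port numbers in use at `v`, in increasing order. -/
noncomputable def ports (v : N.V) : List ℕ :=
  haveI := N.finite
  ((N.graph.neighborSet v).toFinite.image (δ.port v)).toFinset.sort

/-- The vertices of the ball of radius one around `v`: first `v`, then its neighbours ordered by
their port numbers at `v`. -/
noncomputable def ballList (v : N.V) : List N.V :=
  v :: (ports δ v).filterMap (neighborAt δ v)

/-- A port-numbered rooted ball without vertex names: its matrix of port numbers, where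
row `i` and column `j` hold the port number at the `i`-th vertex of the edge
to the `j`-th vertex, and `none` if these two vertices are not adjacent. -/
abbrev BallLabel : Type := List (List (Option ℕ))

open Classical in
/-- The binoculars label of `v`: the subgraph induced by the closed neighbourhood of `v`, rooted at
`v`, with its port numbering. The vertices are anonymous: they are listed in the canonical order of
`ballList`, so that two vertices have the same label exactly when there is a root-preserving,
port-preserving isomorphism between their balls. -/
noncomputable def label (v : N.V) : BallLabel :=
  (ballList δ v).map fun x => (ballList δ v).map fun y =>
    if N.graph.Adj x y then some (δ.port x y) else none

end Labelling

/-! ### Mobile agents -/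

/-- What the agent gets at its current location: the binoculars label of that location, and the port
number (at that location) of the edge by which it arrived, `none` before the first move. -/
abbrev Observation : Type := BallLabel × Option ℕ

/-- An algorithm for a mobile agent: a deterministic machine with unbounded memory and a computable
transition function. Given its memory and its observation it
* halts: `none`;
* or updates its memory to `m` and leaves by port `p`: `some (some p, m)`;
* or updates its memory to `m` without moving: `some (none, m)`. In this way one local computation
  may be spread over several steps, and may also fail to end. -/
structure Agent where
  Mem : Type
  primcodable : Primcodable Mem
  init : Mem
  step : Mem → Observation → Option (Option ℕ × Mem)
  computable : Computable₂ step

/-- The state of a running agent: memory, position, and port of arrival. -/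
structure Config (A : Agent) (N : Network) where
  mem : A.Mem
  pos : N.V
  inPort : Option ℕ

section Execution

variable (A : Agent) {N : Network} (δ : PortNumbering N)

/-- The state reached when the memory is updated to `m` and port `q` is taken. The agent stays where
it is if `q` is `none` or not a port number of its location. -/
noncomputable def Config.advance (c : Config A N) (q : Option ℕ) (m : A.Mem) : Config A N :=
  match q.bind (neighborAt δ c.pos) with
  | none => ⟨m, c.pos, c.inPort⟩
  | some w => ⟨m, w, some (δ.port w c.pos)⟩

/-- One step of the agent, `none` if it halts. -/
noncomputable def Config.next (c : Config A N) : Option (Config A N) :=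
  (A.step c.mem (label δ c.pos, c.inPort)).map fun r => c.advance A δ r.1 r.2

/-- The execution from the homebase `v₀`: the state after `t` steps, `none` once it has halted. -/
noncomputable def run (v₀ : N.V) : ℕ → Option (Config A N)
  | 0 => some ⟨A.init, v₀, none⟩
  | t + 1 => (run v₀ t).bind (Config.next A δ)

/-- The execution from `v₀` terminates. -/
def Halts (v₀ : N.V) : Prop := ∃ t, run A δ v₀ t = none

/-- The agent, started at `v₀`, is at `w` at some time of its execution. -/
def Visits (v₀ w : N.V) : Prop := ∃ t c, run A δ v₀ t = some c ∧ c.pos = w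

end Execution

/-! ### Exploration -/

/-- `A` is an Exploration algorithm: on every network, for every port numbering and every homebase,
either it visits every vertex and terminates, or it never halts. -/
def IsExplorationAlgorithm (A : Agent) : Prop :=
  ∀ (N : Network) (δ : PortNumbering N) (v₀ : N.V),
    (Halts A δ v₀ ∧ ∀ w, Visits A δ v₀ w) ∨ ¬ Halts A δ v₀

/-- A network with a port numbering is explorable: some Exploration algorithm halts on it from every
homebase. -/
def IsExplorableWith (N : Network) (δ : PortNumbering N) : Prop :=
  ∃ A : Agent, IsExplorationAlgorithm A ∧ ∀ v₀ : N.V, Halts A δ v₀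

/-- A network is explorable: some Exploration algorithm halts on it for every port numbering and
from every homebase. -/
def IsExplorable (N : Network) : Prop :=
  ∃ A : Agent, IsExplorationAlgorithm A ∧ ∀ (δ : PortNumbering N) (v₀ : N.V), Halts A δ v₀

/-- A set of networks is explorable: one and the same Exploration algorithm halts on all its
members, for every port numbering and from every homebase. -/
def IsExplorableSet (F : Set Network) : Prop :=
  ∃ A : Agent, IsExplorationAlgorithm A ∧
    ∀ N ∈ F, ∀ (δ : PortNumbering N) (v₀ : N.V), Halts A δ v₀

/-! ### Simplicial complexes and coverings -/

/-- The graph of vertices and edges of a simplicial complex. -/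
def oneSkeleton {W : Type} (K : AbstractSimplicialComplex W) : SimpleGraph W where
  Adj a b := a ≠ b ∧ ∃ s ∈ K.faces, a ∈ s ∧ b ∈ s
  symm := ⟨fun _ _ ⟨h, s, hs, ha, hb⟩ => ⟨h.symm, s, hs, hb, ha⟩⟩
  loopless := ⟨fun _ h => h.1 rfl⟩

/-- The (closed) star of `v`: the simplices containing `v`, and their subsimplices. -/
def star {W : Type} (K : AbstractSimplicialComplex W) (v : W) : Set (Finset W) :=
  {s | s ∈ K.faces ∧ ∃ t ∈ K.faces, v ∈ t ∧ s ⊆ t}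

open Classical in
/-- A map of the vertex sets is a simplicial covering if it sends simplices to simplices and, for
each vertex `v`, restricts to a bijection from the star of `v` onto the star of the image of `v`. -/
def IsSimplicialCovering {W W' : Type} (K : AbstractSimplicialComplex W)
    (K' : AbstractSimplicialComplex W') (f : W → W') : Prop :=
  (∀ s ∈ K.faces, s.image f ∈ K'.faces) ∧
    ∀ v, Set.BijOn (fun s : Finset W => s.image f) (star K v) (star K' (f v))

/-- `μ : U → K` is the universal cover of `K`: `U` is a connected complex, `μ` is a simplicial
covering, and `μ` factors through every simplicial covering of `K` by a connected complex. -/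
def IsUniversalCover {W₀ W : Type} (U : AbstractSimplicialComplex W₀)
    (K : AbstractSimplicialComplex W) (μ : W₀ → W) : Prop :=
  (oneSkeleton U).Connected ∧ IsSimplicialCovering U K μ ∧
    ∀ (W' : Type) (K' : AbstractSimplicialComplex W') (f : W' → W),
      (oneSkeleton K').Connected → IsSimplicialCovering K' K f →
        ∃ g : W₀ → W', IsSimplicialCovering U K' g ∧ f ∘ g = μ

/-- The clique complex of a graph: its simplices are the non-empty finite cliques. -/
def cliqueComplex {V : Type} (G : SimpleGraph V) : AbstractSimplicialComplex V where
  faces := {s | s.Nonempty ∧ G.IsClique (s : Set V)}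
  isRelLowerSet_faces := fun _ hs =>
    ⟨hs.1, fun _ hts ht => ⟨ht, hs.2.subset (Finset.coe_subset.2 hts)⟩⟩
  singleton_mem v := ⟨Finset.singleton_nonempty v, by simp⟩

/-- The networks whose clique complex has a finite universal cover. -/
def FNT : Set Network :=
  {N | ∃ (W : Type) (U : AbstractSimplicialComplex W) (μ : W → N.V),
    IsUniversalCover U (cliqueComplex N.graph) μ ∧ Finite W}

end Binoculars

namespace Binoculars

/-! ### Simplicial coverings -/

section Covering

variable {W W' : Type} {K : AbstractSimplicialComplex W} {K' : AbstractSimplicialComplex W'}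
  {f : W → W'}

/-! The universal cover of the clique complex of `G` can be made concrete: its vertices are the
homotopy classes of walks from `v₀`, where homotopy is generated by removing backtracks and
short-cutting triangles (`isUniversalCover_cover`). Any other universal cover maps onto this one, so
membership in `FNT` means that there are finitely many classes (`mem_FNT_iff`).

Necessity is an indistinguishability argument. The cover looks like `G` in every ball of radius one,
so an agent starting at the root of a large ball of the cover, with lifted ports, receives the same
observations as on `G` until it can be near the boundary (`run_coverBall`). If it halts on `G` at
time `T` and the cover is infinite, it also halts at time `T` on the ball of radius `T + 1`, which
has a vertex outside the ball of radius `T`; that vertex was not visited (`finite_cover_of_halts`).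
One port numbering and one homebase suffice.

Sufficiency comes from a single agent, `explorer`, which tries all finite instruction lists one
after the other. Its instructions are guarded by what the label certifies, so a wrong list is
harmless: paths in `seen` lead to visited vertices, and every neighbour of such a vertex is itself
the end of a path in `seen`, the end of the current path, or the end of a path in `todo` (`Sound`).
Halting with nothing left therefore gives a set of visited vertices closed under adjacency, hence
everything.

If the cover is finite, some list succeeds. Each elementary homotopy takes place inside one visible
ball, so instructions can replace the path to a target by a chosen representative of its class
(`Homotopic.trans_right`). Then only finitely many paths are ever examined and `todo` is eventually
exhausted (`succeeds_of_fintype`). Vertices are never recognised; only paths are compared. -/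

theorem mem_star_of_mem {s : Finset W} {v : W} (hs : s ∈ K.faces) (hv : v ∈ s) : s ∈ star K v :=
  ⟨hs, s, hs, hv, subset_rfl⟩

theorem face_of_subset {s t : Finset W} (ht : t ∈ K.faces) (hst : s ⊆ t) (hs : s.Nonempty) :
    s ∈ K.faces :=
  (K.isRelLowerSet_faces ht).2 hst hs

theorem oneSkeleton_cliqueComplex (G : SimpleGraph W) : oneSkeleton (cliqueComplex G) = G := by
  classical
  ext a b
  constructor
  · rintro ⟨h, s, hs, ha, hb⟩
    exact hs.2 ha hb h
  · intro h
    refine ⟨h.ne, {a, b}, ⟨by simp, ?_⟩, by simp, by simp⟩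
    simp [h]

/-- A singleton of the star: the vertices joined to `v`. -/
theorem singleton_mem_star {v x : W} :
    {x} ∈ star K v ↔ x = v ∨ (oneSkeleton K).Adj v x := by
  constructor
  · rintro ⟨-, t, ht, hv, hx⟩
    by_cases h : x = v
    · exact Or.inl h
    · exact Or.inr ⟨Ne.symm h, t, ht, hv, by simpa using hx⟩
  · rintro (rfl | ⟨-, t, ht, hv, hx⟩)
    · exact ⟨K.singleton_mem _, {x}, K.singleton_mem _, by simp, subset_rfl⟩
    · exact ⟨K.singleton_mem _, t, ht, hv, by simpa using hx⟩

namespace IsSimplicialCovering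

theorem injOn (hf : IsSimplicialCovering K K' f) {v x y : W} (hx : {x} ∈ star K v)
    (hy : {y} ∈ star K v) (h : f x = f y) : x = y := by
  have := (hf.2 v).injOn hx hy (by simp [h])
  simpa using this

theorem map_adj (hf : IsSimplicialCovering K K' f) {x y : W} (h : (oneSkeleton K).Adj x y) :
    (oneSkeleton K').Adj (f x) (f y) := by
  classical
  refine ⟨fun he => h.1 (hf.injOn (v := x) (singleton_mem_star.2 (Or.inl rfl))
    (singleton_mem_star.2 (Or.inr h)) he), ?_⟩
  obtain ⟨-, s, hs, hx, hy⟩ := h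
  exact ⟨_, hf.1 s hs, Finset.mem_image_of_mem _ hx, Finset.mem_image_of_mem _ hy⟩

/-- Surjectivity on stars yields a simplex that merely lies in the star of `v`; injectivity on that
star forces `v` into it. -/
theorem exists_face (hf : IsSimplicialCovering K K' f) {v : W} {s : Finset W'} (hs : s ∈ K'.faces)
    (hv : f v ∈ s) : ∃ t ∈ K.faces, v ∈ t ∧ ∀ y, y ∈ s ↔ ∃ z ∈ t, f z = y := by
  classical
  obtain ⟨t, ⟨ht, u, hu, hvu, htu⟩, rfl⟩ := (hf.2 v).surjOn (mem_star_of_mem hs hv)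
  refine ⟨t, ht, ?_, fun y => by simp⟩
  obtain ⟨z, hz, hzv⟩ := Finset.mem_image.1 hv
  have : z = v := hf.injOn (v := v) ⟨K.singleton_mem _, u, hu, hvu, by simpa using htu hz⟩
    (singleton_mem_star.2 (Or.inl rfl)) hzv
  exact this ▸ hz

theorem exists_adj (hf : IsSimplicialCovering K K' f) {v : W} {y : W'}
    (h : (oneSkeleton K').Adj (f v) y) : ∃ x, (oneSkeleton K).Adj v x ∧ f x = y := by
  obtain ⟨hne, s, hs, hv, hy⟩ := h
  obtain ⟨t, ht, hvt, hst⟩ := hf.exists_face hs hv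
  obtain ⟨x, hx, rfl⟩ := (hst y).1 hy
  exact ⟨x, ⟨fun h => hne (by rw [h]), t, ht, hvt, hx⟩, rfl⟩

theorem eq_of_adj (hf : IsSimplicialCovering K K' f) {v x y : W} (hx : (oneSkeleton K).Adj v x)
    (hy : (oneSkeleton K).Adj v y) (h : f x = f y) : x = y :=
  hf.injOn (v := v) (singleton_mem_star.2 (Or.inr hx)) (singleton_mem_star.2 (Or.inr hy)) h

/-- Lift `s` to a simplex at `v`. A neighbour of `v` is the only vertex of the star over its image,
so `x` and `y` both belong to the lift. -/
theorem adj_of_triangle (hf : IsSimplicialCovering K K' f) {v x y : W}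
    (hx : (oneSkeleton K).Adj v x) (hy : (oneSkeleton K).Adj v y) {s : Finset W'}
    (hs : s ∈ K'.faces) (hvs : f v ∈ s) (hxs : f x ∈ s) (hys : f y ∈ s) (hxy : x ≠ y) :
    (oneSkeleton K).Adj x y := by
  obtain ⟨t, ht, hvt, hst⟩ := hf.exists_face hs hvs
  have key : ∀ z, (oneSkeleton K).Adj v z → f z ∈ s → z ∈ t := by
    intro z hz hzs
    obtain ⟨z', hz', he⟩ := (hst _).1 hzs
    have : z' = z := hf.injOn (v := v)
      ⟨K.singleton_mem _, t, ht, hvt, by simpa using hz'⟩ (singleton_mem_star.2 (Or.inr hz)) he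
    exact this ▸ hz'
  exact ⟨hxy, t, ht, key x hx hxs, key y hy hys⟩

theorem surjective (hf : IsSimplicialCovering K K' f) (hK : Nonempty W)
    (hK' : (oneSkeleton K').Preconnected) : Function.Surjective f := by
  obtain ⟨x₀⟩ := hK
  intro y
  obtain ⟨p⟩ := hK' (f x₀) y
  suffices ∀ a b, (oneSkeleton K').Walk a b → (∃ x, f x = a) → ∃ x, f x = b from
    this _ _ p ⟨x₀, rfl⟩
  intro a b q
  induction q with
  | nil => exact id
  | cons h q ih =>
    rintro ⟨x, rfl⟩
    obtain ⟨z, -, hz⟩ := hf.exists_adj h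
    exact ih ⟨z, hz⟩

/-- A map that preserves the edges and factors a covering through a covering is a covering. -/
theorem of_comp {W₁ : Type} {K₁ : AbstractSimplicialComplex W₁} {g : W₁ → W}
    (hf : IsSimplicialCovering K K' f) (hfg : IsSimplicialCovering K₁ K' (f ∘ g))
    (hg : ∀ x y, (oneSkeleton K₁).Adj x y → (oneSkeleton K).Adj (g x) (g y)) :
    IsSimplicialCovering K₁ K g := by
  classical
  have himg : ∀ s : Finset W₁, s.image (f ∘ g) = (s.image g).image f := fun s => by
    rw [Finset.image_image]
  have hfaces : ∀ s ∈ K₁.faces, s.image g ∈ K.faces := by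
    intro s hs
    obtain ⟨x, hx⟩ := (K₁.isRelLowerSet_faces hs).1
    -- Lift `f (g s)` to a simplex `t` at `g x`; injectivity of `f` on the star of `g x` puts every
    -- vertex of `g s` in `t`.
    obtain ⟨t, ht, hxt, hst⟩ := hf.exists_face (v := g x) (hfg.1 s hs)
      (Finset.mem_image_of_mem _ hx)
    refine face_of_subset ht ?_ (Finset.Nonempty.image ⟨x, hx⟩ _)
    intro z hz
    obtain ⟨y, hy, rfl⟩ := Finset.mem_image.1 hz
    obtain ⟨z', hz', he⟩ := (hst (f (g y))).1 (Finset.mem_image_of_mem (f ∘ g) hy)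
    have : z' = g y := by
      refine hf.injOn (v := g x) ⟨K.singleton_mem _, t, ht, hxt, by simpa using hz'⟩ ?_ he
      rw [singleton_mem_star]
      by_cases hxy : x = y
      · exact Or.inl (by rw [hxy])
      · exact Or.inr (hg x y ⟨hxy, s, hs, hx, hy⟩)
    exact this ▸ hz'
  refine ⟨fun s hs => by convert hfaces s hs, fun v => ?_⟩
  have hmaps : Set.MapsTo (fun s : Finset W₁ => s.image g) (star K₁ v) (star K (g v)) := by
    rintro s ⟨hs, t, ht, hv, hst⟩
    exact ⟨hfaces s hs, _, hfaces t ht, Finset.mem_image_of_mem _ hv, Finset.image_subset_image hst⟩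
  have h1 := hf.2 (g v)
  have h2 : Set.BijOn (fun s : Finset W₁ => (s.image g).image f) (star K₁ v) (star K' (f (g v))) := by
    have := hfg.2 v
    convert this using 2 with s
    rw [← himg]
    congr!
  have h3 : Set.BijOn (fun s : Finset W₁ => s.image g) (star K₁ v) (star K (g v)) := by
    refine ⟨hmaps, fun s hs t ht h => h2.injOn hs ht (by simp only at h ⊢; rw [h]), ?_⟩
    intro u hu
    -- For surjectivity, pull `f u` back along `f ∘ g` and cancel `f`, which is injective on the
    -- star of `g v`.
    have hu' : u.image f ∈ star K' (f (g v)) := by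
      have := h1.mapsTo hu
      convert this
    obtain ⟨s, hs, he⟩ := h2.surjOn hu'
    refine ⟨s, hs, h1.injOn (hmaps hs) hu ?_⟩
    simp only at he ⊢
    convert he
  convert h3

end IsSimplicialCovering

/-- A graph homomorphism which is bijective on closed neighbourhoods, and under which adjacency
lifts to them, is a covering of the clique complexes. -/
theorem isSimplicialCovering_cliqueComplex {H : SimpleGraph W} {G : SimpleGraph W'}
    (hom : ∀ x y, H.Adj x y → G.Adj (f x) (f y))
    (inj : ∀ v x y, H.Adj v x → H.Adj v y → f x = f y → x = y)
    (surj : ∀ v y, G.Adj (f v) y → ∃ x, H.Adj v x ∧ f x = y)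
    (tri : ∀ v x y, H.Adj v x → H.Adj v y → G.Adj (f x) (f y) → H.Adj x y) :
    IsSimplicialCovering (cliqueComplex H) (cliqueComplex G) f := by
  classical
  have hfaces : ∀ s ∈ (cliqueComplex H).faces, s.image f ∈ (cliqueComplex G).faces := by
    rintro s ⟨hne, hs⟩
    refine ⟨hne.image _, ?_⟩
    intro a ha b hb hab
    obtain ⟨x, hx, rfl⟩ := Finset.mem_image.1 (Finset.mem_coe.1 ha)
    obtain ⟨y, hy, rfl⟩ := Finset.mem_image.1 (Finset.mem_coe.1 hb)
    exact hom _ _ (hs hx hy fun h => hab (by rw [h]))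
  have hball : ∀ (v : W) (s : Finset W), s ∈ star (cliqueComplex H) v →
      ∀ x ∈ s, x = v ∨ H.Adj v x := by
    rintro v s ⟨-, t, ht, hv, hst⟩ x hx
    by_cases h : x = v
    · exact Or.inl h
    · exact Or.inr (ht.2 hv (hst hx) (Ne.symm h))
  have hinj : ∀ v x y, (x = v ∨ H.Adj v x) → (y = v ∨ H.Adj v y) → f x = f y → x = y := by
    rintro v x y (rfl | hx) (rfl | hy) h
    · rfl
    · exact ((hom _ _ hy).ne h).elim
    · exact ((hom _ _ hx).ne h.symm).elim
    · exact inj v x y hx hy h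
  have main : ∀ v, Set.BijOn (fun s : Finset W => s.image f) (star (cliqueComplex H) v)
      (star (cliqueComplex G) (f v)) := by
    intro v
    refine ⟨?_, ?_, ?_⟩
    · rintro s ⟨hs, t, ht, hv, hst⟩
      exact ⟨hfaces s hs, _, hfaces t ht, Finset.mem_image_of_mem _ hv,
        Finset.image_subset_image hst⟩
    · intro s hs t ht h
      simp only at h
      have aux : ∀ s t : Finset W, s ∈ star (cliqueComplex H) v → t ∈ star (cliqueComplex H) v →
          s.image f = t.image f → s ⊆ t := by
        intro s t hs ht h x hx
        obtain ⟨y, hy, he⟩ := Finset.mem_image.1 (h ▸ Finset.mem_image_of_mem f hx)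
        exact hinj v y x (hball v t ht y hy) (hball v s hs x hx) he ▸ hy
      exact (aux s t hs ht h).antisymm (aux t s ht hs h.symm)
    · rintro u ⟨hu, t, ht, hv, hut⟩
      have hadj : ∀ a ∈ t, ∃ x, (x = v ∨ H.Adj v x) ∧ f x = a := by
        intro a ha
        by_cases h : f v = a
        · exact ⟨v, Or.inl rfl, h⟩
        · obtain ⟨x, hx, he⟩ := surj v a (ht.2 hv ha h)
          exact ⟨x, Or.inr hx, he⟩
      have : Nonempty W := ⟨v⟩
      -- `l` lifts each vertex of the clique `t` to the closed neighbourhood of `v`; by `tri` it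
      -- carries subsets of `t` to cliques.
      choose! l hl1 hl2 using hadj
      have hlc : ∀ r : Finset W', r ⊆ t → H.IsClique (r.image l : Finset W) := by
        intro r hr x hx y hy hxy
        obtain ⟨a, ha, rfl⟩ := Finset.mem_image.1 (Finset.mem_coe.1 hx)
        obtain ⟨b, hb, rfl⟩ := Finset.mem_image.1 (Finset.mem_coe.1 hy)
        have hab : G.Adj (f (l a)) (f (l b)) := by
          rw [hl2 a (hr ha), hl2 b (hr hb)]
          exact ht.2 (hr ha) (hr hb) fun h => hxy (by rw [h])
        rcases hl1 a (hr ha) with h1 | h1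
        · rcases hl1 b (hr hb) with h2 | h2
          · exact (hxy (h1.trans h2.symm)).elim
          · rw [h1]; exact h2
        · rcases hl1 b (hr hb) with h2 | h2
          · rw [h2]; exact h1.symm
          · exact tri v _ _ h1 h2 hab
      have hlv : l (f v) = v := by
        exact hinj v _ _ (hl1 _ hv) (Or.inl rfl) (hl2 _ hv)
      refine ⟨u.image l, ⟨⟨hu.1.image _, hlc u hut⟩, t.image l, ⟨⟨_, Finset.mem_image_of_mem l hv⟩,
        hlc t subset_rfl⟩, ?_, Finset.image_subset_image hut⟩, ?_⟩
      · exact hlv ▸ Finset.mem_image_of_mem l hv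
      · simp only [Finset.image_image]
        ext a
        simp only [Finset.mem_image, Function.comp]
        constructor
        · rintro ⟨b, hb, rfl⟩
          rwa [hl2 b (hut hb)]
        · intro ha
          exact ⟨a, ha, hl2 a (hut ha)⟩
  refine ⟨fun s hs => by convert hfaces s hs, fun v => ?_⟩
  convert main v

end Covering

/-! ### Homotopy of walks and the universal cover of the clique complex of a graph -/

section Homotopy

variable {V : Type} {G : SimpleGraph V}

/-- Homotopy of walks in the clique complex: generated by the removal of backtracks and the
replacement of two sides of a triangle by the third. -/
inductive Homotopic : ∀ {u v : V}, G.Walk u v → G.Walk u v → Prop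
  | refl {u v : V} (p : G.Walk u v) : Homotopic p p
  | symm {u v : V} {p q : G.Walk u v} : Homotopic p q → Homotopic q p
  | trans {u v : V} {p q r : G.Walk u v} : Homotopic p q → Homotopic q r → Homotopic p r
  | cons {u v w : V} (h : G.Adj u v) {p q : G.Walk v w} :
      Homotopic p q → Homotopic (.cons h p) (.cons h q)
  | backtrack {u v w : V} (h : G.Adj u v) (p : G.Walk u w) :
      Homotopic (.cons h (.cons h.symm p)) p
  | triangle {u v w x : V} (h : G.Adj u v) (h' : G.Adj v w) (h'' : G.Adj u w) (p : G.Walk w x) :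
      Homotopic (.cons h (.cons h' p)) (.cons h'' p)

theorem Homotopic.append_right {u v w : V} {p q : G.Walk u v} (h : Homotopic p q)
    (r : G.Walk v w) : Homotopic (p.append r) (q.append r) := by
  induction h with
  | refl p => exact .refl _
  | symm _ ih => exact (ih r).symm
  | trans _ _ ih₁ ih₂ => exact (ih₁ r).trans (ih₂ r)
  | cons h _ ih => exact .cons h (ih r)
  | backtrack h p => exact .backtrack h _
  | triangle h h' h'' p => exact .triangle h h' h'' _

theorem Homotopic.append_left {u v w : V} (r : G.Walk u v) {p q : G.Walk v w}
    (h : Homotopic p q) : Homotopic (r.append p) (r.append q) := by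
  induction r with
  | nil => exact h
  | cons h' r ih => exact .cons h' (ih h)

variable (G) in
/-- Homotopy as an equivalence relation on the walks from `u` to `v`. -/
def homotopySetoid (u v : V) : Setoid (G.Walk u v) :=
  ⟨Homotopic, .refl, .symm, .trans⟩

variable (G) in
/-- The vertices of the universal cover: the homotopy classes of walks from `v₀`. -/
abbrev Cover (v₀ : V) : Type := Σ v, Quotient (homotopySetoid G v₀ v)

/-- The homotopy class of a walk. -/
def Cover.mk {v₀ v : V} (p : G.Walk v₀ v) : Cover G v₀ := ⟨v, Quotient.mk _ p⟩

theorem Cover.mk_eq_mk {v₀ v : V} {p q : G.Walk v₀ v} :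
    Cover.mk p = Cover.mk q ↔ Homotopic p q := by
  constructor
  · intro h
    have := eq_of_heq (Sigma.mk.inj h).2
    exact Quotient.exact this
  · intro h
    exact congrArg (Sigma.mk v) (Quotient.sound h)

theorem Cover.exists_mk {v₀ : V} (x : Cover G v₀) : ∃ p : G.Walk v₀ x.1, x = Cover.mk p := by
  obtain ⟨v, c⟩ := x
  induction c using Quotient.ind with
  | _ p => exact ⟨p, rfl⟩

variable (G) in
/-- The one-skeleton of the universal cover. -/
def coverGraph (v₀ : V) : SimpleGraph (Cover G v₀) where
  Adj x y := ∃ (v w : V) (p : G.Walk v₀ v) (h : G.Adj v w),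
    x = Cover.mk p ∧ y = Cover.mk (p.append (.cons h .nil))
  symm := ⟨by
    rintro _ _ ⟨v, w, p, h, rfl, rfl⟩
    refine ⟨w, v, p.append (.cons h .nil), h.symm, rfl, ?_⟩
    rw [Cover.mk_eq_mk, ← SimpleGraph.Walk.append_assoc]
    exact (by simpa using Homotopic.append_left p (Homotopic.backtrack h .nil) :
      Homotopic (p.append _) p).symm⟩
  loopless := ⟨by
    rintro _ ⟨v, w, p, h, rfl, he⟩
    exact h.ne (congrArg Sigma.fst he)⟩

theorem coverGraph_adj_mk {v₀ v : V} {p : G.Walk v₀ v} {y : Cover G v₀} :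
    (coverGraph G v₀).Adj (Cover.mk p) y ↔
      ∃ (w : V) (h : G.Adj v w), y = Cover.mk (p.append (.cons h .nil)) := by
  constructor
  · rintro ⟨v', w, q, h, he, rfl⟩
    obtain rfl : v = v' := congrArg Sigma.fst he
    exact ⟨w, h, Cover.mk_eq_mk.2 ((Cover.mk_eq_mk.1 he).symm.append_right _)⟩
  · rintro ⟨w, h, rfl⟩
    exact ⟨v, w, p, h, rfl, rfl⟩

theorem coverGraph_hom {v₀ : V} {x y : Cover G v₀} (h : (coverGraph G v₀).Adj x y) :
    G.Adj x.1 y.1 := by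
  obtain ⟨v, w, p, h, rfl, rfl⟩ := h
  exact h

theorem coverGraph_inj {v₀ : V} {x y z : Cover G v₀} (hy : (coverGraph G v₀).Adj x y)
    (hz : (coverGraph G v₀).Adj x z) (h : y.1 = z.1) : y = z := by
  obtain ⟨p, hp⟩ := x.exists_mk
  rw [hp, coverGraph_adj_mk] at hy hz
  obtain ⟨a, ha, rfl⟩ := hy
  obtain ⟨b, hb, rfl⟩ := hz
  obtain rfl : a = b := h
  rfl

theorem coverGraph_surj {v₀ : V} {x : Cover G v₀} {w : V} (h : G.Adj x.1 w) :
    ∃ y, (coverGraph G v₀).Adj x y ∧ y.1 = w := by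
  obtain ⟨p, hp⟩ := x.exists_mk
  exact ⟨Cover.mk (p.append (.cons h .nil)), ⟨x.1, w, p, h, hp, rfl⟩, rfl⟩

/-- Going to `z` through `y` is homotopic to going there directly, by the triangle move. This is
what makes the projection a covering of clique complexes and not only of graphs. -/
theorem coverGraph_triangle {v₀ : V} {x y z : Cover G v₀} (hy : (coverGraph G v₀).Adj x y)
    (hz : (coverGraph G v₀).Adj x z) (h : G.Adj y.1 z.1) : (coverGraph G v₀).Adj y z := by
  obtain ⟨p, hp⟩ := x.exists_mk
  rw [hp, coverGraph_adj_mk] at hy hz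
  obtain ⟨a, ha, rfl⟩ := hy
  obtain ⟨b, hb, rfl⟩ := hz
  rw [coverGraph_adj_mk]
  refine ⟨b, h, ?_⟩
  rw [Cover.mk_eq_mk, ← SimpleGraph.Walk.append_assoc]
  exact (Homotopic.append_left p (Homotopic.triangle ha h hb .nil)).symm

theorem coverGraph_connected (v₀ : V) : (coverGraph G v₀).Connected := by
  have key : ∀ (u v : V) (q : G.Walk u v) (p : G.Walk v₀ u),
      (coverGraph G v₀).Reachable (Cover.mk p) (Cover.mk (p.append q)) := by
    intro u v q
    induction q with
    | nil => intro p; simp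
    | cons h q ih =>
      intro p
      have h1 : (coverGraph G v₀).Adj (Cover.mk p) (Cover.mk (p.append (.cons h .nil))) :=
        coverGraph_adj_mk.2 ⟨_, h, rfl⟩
      have h2 := ih (p.append (.cons h .nil))
      rw [← SimpleGraph.Walk.append_assoc] at h2
      exact h1.reachable.trans h2
  have key' : ∀ x, (coverGraph G v₀).Reachable (Cover.mk .nil) x := by
    intro x
    obtain ⟨p, hp⟩ := x.exists_mk
    rw [hp]
    simpa using key _ _ p .nil
  exact { preconnected := fun x y => (key' x).symm.trans (key' y), nonempty := ⟨Cover.mk .nil⟩ }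

theorem isSimplicialCovering_cover (v₀ : V) :
    IsSimplicialCovering (cliqueComplex (coverGraph G v₀)) (cliqueComplex G) Sigma.fst :=
  isSimplicialCovering_cliqueComplex (fun _ _ => coverGraph_hom) (fun _ _ _ => coverGraph_inj)
    (fun _ _ => coverGraph_surj) (fun _ _ _ => coverGraph_triangle)

/-! ### Lifting walks through a covering -/

section Lift

variable {W' : Type} {K' : AbstractSimplicialComplex W'} {f : W' → V}

open Classical in
/-- The neighbour of `x` over `v`, if there is one. -/
noncomputable def liftStep (K' : AbstractSimplicialComplex W') (f : W' → V) (x : W') (v : V) : W' :=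
  -- The default `x` does not occur for a covering `f` and a neighbour `v` of `f x`, by
  -- `liftStep_spec`.
  if h : ∃ y, (oneSkeleton K').Adj x y ∧ f y = v then h.choose else x

/-- The end of the lift to `x` of a walk. -/
noncomputable def liftEnd (K' : AbstractSimplicialComplex W') (f : W' → V) :
    ∀ {u v : V}, W' → G.Walk u v → W'
  | _, _, x, .nil => x
  | _, _, x, .cons (v := v) _ p => liftEnd K' f (liftStep K' f x v) p

theorem liftEnd_append {u v w : V} (p : G.Walk u v) (q : G.Walk v w) (x : W') :
    liftEnd K' f x (p.append q) = liftEnd K' f (liftEnd K' f x p) q := by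
  induction p generalizing x with
  | nil => rfl
  | cons h p ih => exact ih q _

theorem liftStep_spec (hf : IsSimplicialCovering K' (cliqueComplex G) f)
    {x : W'} {v : V} (h : G.Adj (f x) v) :
    (oneSkeleton K').Adj x (liftStep K' f x v) ∧ f (liftStep K' f x v) = v := by
  have hex : ∃ y, (oneSkeleton K').Adj x y ∧ f y = v :=
    hf.exists_adj (by rwa [oneSkeleton_cliqueComplex])
  rw [liftStep, dif_pos hex]
  exact hex.choose_spec

theorem liftStep_eq (hf : IsSimplicialCovering K' (cliqueComplex G) f)
    {x y : W'} (h : (oneSkeleton K').Adj x y) : liftStep K' f x (f y) = y := by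
  have hadj : G.Adj (f x) (f y) := by simpa [oneSkeleton_cliqueComplex] using hf.map_adj h
  have := liftStep_spec hf hadj
  exact hf.eq_of_adj this.1 h this.2

theorem map_liftEnd (hf : IsSimplicialCovering K' (cliqueComplex G) f) {u v : V}
    (p : G.Walk u v) {x : W'} (hx : f x = u) :
    f (liftEnd K' f x p) = v := by
  induction p generalizing x with
  | nil => exact hx
  | cons h p ih =>
    subst hx
    exact ih (liftStep_spec hf h).2

/-- Backtracks lift to backtracks because a neighbour of a given vertex is determined by its image;
triangles lift to triangles because the star of `x` contains a lift of the simplex. -/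
theorem Homotopic.liftEnd_eq (hf : IsSimplicialCovering K' (cliqueComplex G) f)
    {u v : V} {p q : G.Walk u v} (h : Homotopic p q) {x : W'} (hx : f x = u) :
    liftEnd K' f x p = liftEnd K' f x q := by
  induction h generalizing x with
  | refl p => rfl
  | symm _ ih => exact (ih hx).symm
  | trans _ _ ih₁ ih₂ => exact (ih₁ hx).trans (ih₂ hx)
  | cons h _ ih =>
    subst hx
    exact ih (liftStep_spec hf h).2
  | backtrack h p =>
    subst hx
    have h1 := liftStep_spec hf h
    simp only [liftEnd]
    rw [liftStep_eq hf h1.1.symm]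
  | triangle h h' h'' p =>
    rename_i u' v' w' x'
    classical
    subst hx
    have h1 := liftStep_spec hf h
    have h2 := liftStep_spec hf h''
    simp only [liftEnd]
    congr 1
    have h3 : (oneSkeleton K').Adj (liftStep K' f x v') (liftStep K' f x w') := by
      refine hf.adj_of_triangle (s := {f x, v', w'}) h1.1 h2.1 ⟨by simp, ?_⟩ (by simp)
        (by rw [h1.2]; simp) (by rw [h2.2]; simp) ?_
      · intro a ha b hb hab
        simp only [Finset.coe_insert, Finset.coe_singleton, Set.mem_insert_iff,
          Set.mem_singleton_iff] at ha hb
        rcases ha with rfl | rfl | rfl <;> rcases hb with rfl | rfl | rfl <;>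
          first
          | exact (hab rfl).elim
          | exact h | exact h' | exact h'' | exact h.symm | exact h'.symm | exact h''.symm
      · intro he
        exact h'.ne (by rw [← h1.2, he, h2.2])
    have h4 := liftStep_eq hf h3
    rwa [h2.2] at h4

end Lift

/-- Send the class of a walk to the end of its lift at a fixed point over `v₀`. Extending a walk by
an edge extends its lift by an edge, so this map preserves adjacency, and `of_comp` makes it a
covering. -/
theorem isUniversalCover_cover (hG : G.Connected) (v₀ : V) :
    IsUniversalCover (cliqueComplex (coverGraph G v₀)) (cliqueComplex G) Sigma.fst := by
  refine ⟨by rw [oneSkeleton_cliqueComplex]; exact coverGraph_connected v₀,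
    isSimplicialCovering_cover v₀, ?_⟩
  intro W' K' f hK' hf
  obtain ⟨x₀, hx₀⟩ := hf.surjective hK'.nonempty
    (by rw [oneSkeleton_cliqueComplex]; exact hG.preconnected) v₀
  let g : Cover G v₀ → W' := fun x =>
    Quotient.lift (fun p => liftEnd K' f x₀ p) (fun _ _ h => Homotopic.liftEnd_eq hf h hx₀) x.2
  have hg : ∀ {v} (p : G.Walk v₀ v), g (Cover.mk p) = liftEnd K' f x₀ p := fun p => rfl
  have hfg : f ∘ g = Sigma.fst := by
    funext x
    obtain ⟨p, hp⟩ := x.exists_mk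
    rw [hp]
    exact map_liftEnd hf p hx₀
  refine ⟨g, hf.of_comp (by rw [hfg]; exact isSimplicialCovering_cover v₀) ?_, hfg⟩
  intro x y hxy
  rw [oneSkeleton_cliqueComplex] at hxy
  obtain ⟨v, w, p, h, rfl, rfl⟩ := hxy
  rw [hg, hg, liftEnd_append]
  have hv : f (liftEnd K' f x₀ p) = v := map_liftEnd hf p hx₀
  exact (liftStep_spec hf (by rwa [hv])).1

end Homotopy

/-- The universal cover is unique up to the finiteness of its vertex set. -/
theorem mem_FNT_iff {N : Network} (v₀ : N.V) : N ∈ FNT ↔ Finite (Cover N.graph v₀) := by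
  constructor
  · rintro ⟨W, U, μ, ⟨hU, hμ, h⟩, hfin⟩
    -- Universality of `U` gives a covering of the concrete cover, onto because the latter is
    -- connected; finiteness passes to the image.
    obtain ⟨g, hg, -⟩ := h _ (cliqueComplex (coverGraph N.graph v₀)) Sigma.fst
      (by rw [oneSkeleton_cliqueComplex]; exact coverGraph_connected v₀)
      (isSimplicialCovering_cover v₀)
    exact Finite.of_surjective g (hg.surjective hU.nonempty
      (by rw [oneSkeleton_cliqueComplex]; exact (coverGraph_connected v₀).preconnected))
  · intro h
    exact ⟨_, _, _, isUniversalCover_cover N.connected v₀, h⟩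

/-! ### Balls and labels -/

section Balls

variable {N : Network} (δ : PortNumbering N)

theorem neighborAt_eq_some {v w : N.V} {p : ℕ} :
    neighborAt δ v p = some w ↔ N.graph.Adj v w ∧ δ.port v w = p := by
  unfold neighborAt
  constructor
  · intro h
    split_ifs at h with hex
    obtain rfl := Option.some.inj h
    exact hex.choose_spec
  · intro h
    have hex : ∃ w, N.graph.Adj v w ∧ δ.port v w = p := ⟨w, h⟩
    rw [dif_pos hex]
    exact congrArg some (δ.injOn v hex.choose_spec.1 h.1 (hex.choose_spec.2.trans h.2.symm))

theorem neighborAt_port {v w : N.V} (h : N.graph.Adj v w) :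
    neighborAt δ v (δ.port v w) = some w :=
  (neighborAt_eq_some δ).2 ⟨h, rfl⟩

theorem mem_ports {v : N.V} {p : ℕ} : p ∈ ports δ v ↔ ∃ w, N.graph.Adj v w ∧ δ.port v w = p := by
  simp [ports]

theorem mem_ballList {v x : N.V} : x ∈ ballList δ v ↔ x = v ∨ N.graph.Adj v x := by
  simp only [ballList, List.mem_cons, List.mem_filterMap, neighborAt_eq_some]
  refine or_congr Iff.rfl ⟨fun ⟨_, _, h, _⟩ => h, fun h => ⟨_, ?_, h, rfl⟩⟩
  exact (mem_ports δ).2 ⟨x, h, rfl⟩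

theorem nodup_ballList (v : N.V) : (ballList δ v).Nodup := by
  rw [ballList, List.nodup_cons]
  constructor
  · simp only [List.mem_filterMap, neighborAt_eq_some]
    rintro ⟨_, _, h, _⟩
    exact h.ne rfl
  · refine List.Nodup.filterMap ?_ (Finset.sort_nodup _ _)
    intro a a' b ha ha'
    rw [Option.mem_def, neighborAt_eq_some] at ha ha'
    exact ha.2.symm.trans ha'.2

end Balls

/-- A map that respects edges and port numbers and is an isomorphism on the ball around `x`
preserves the label of `x`. -/
structure IsLocalIsoAt {N' N : Network} (δ' : PortNumbering N') (δ : PortNumbering N)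
    (f : N'.V → N.V) (x : N'.V) : Prop where
  hom : ∀ y z, N'.graph.Adj y z → N.graph.Adj (f y) (f z)
  port : ∀ y z, N'.graph.Adj y z → δ.port (f y) (f z) = δ'.port y z
  surj : ∀ w, N.graph.Adj (f x) w → ∃ y, N'.graph.Adj x y ∧ f y = w
  triangle : ∀ y z, N'.graph.Adj x y → N'.graph.Adj x z → N.graph.Adj (f y) (f z) →
    N'.graph.Adj y z

namespace IsLocalIsoAt

variable {N' N : Network} {δ' : PortNumbering N'} {δ : PortNumbering N} {f : N'.V → N.V} {x : N'.V}

theorem map_neighborAt (h : IsLocalIsoAt δ' δ f x) (q : ℕ) :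
    (neighborAt δ' x q).map f = neighborAt δ (f x) q := by
  ext w
  simp only [Option.map_eq_some_iff, neighborAt_eq_some]
  constructor
  · rintro ⟨y, ⟨hxy, hq⟩, rfl⟩
    exact ⟨h.hom _ _ hxy, (h.port _ _ hxy).trans hq⟩
  · rintro ⟨hxw, hq⟩
    obtain ⟨y, hy, rfl⟩ := h.surj w hxw
    exact ⟨y, ⟨hy, (h.port _ _ hy).symm.trans hq⟩, rfl⟩

theorem ports_eq (h : IsLocalIsoAt δ' δ f x) : ports δ' x = ports δ (f x) := by
  unfold ports
  congr 1
  ext q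
  simp only [Set.Finite.mem_toFinset, Set.mem_image, SimpleGraph.mem_neighborSet]
  constructor
  · rintro ⟨y, hxy, hq⟩
    exact ⟨f y, h.hom _ _ hxy, (h.port _ _ hxy).trans hq⟩
  · rintro ⟨w, hxw, hq⟩
    obtain ⟨y, hy, rfl⟩ := h.surj w hxw
    exact ⟨y, hy, (h.port _ _ hy).symm.trans hq⟩

/-- Both lists are sorted by port number and `f` preserves ports, so they correspond entry by entry.
-/
theorem map_ballList (h : IsLocalIsoAt δ' δ f x) :
    (ballList δ' x).map f = ballList δ (f x) := by
  rw [ballList, ballList, List.map_cons, List.map_filterMap, h.ports_eq]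
  congr 2
  funext q
  exact h.map_neighborAt q

theorem label_eq (h : IsLocalIsoAt δ' δ f x) : label δ (f x) = label δ' x := by
  unfold label
  rw [← h.map_ballList, List.map_map]
  refine List.map_congr_left fun y hy => ?_
  simp only [Function.comp, List.map_map]
  refine List.map_congr_left fun z hz => ?_
  rw [mem_ballList] at hy hz
  have hadj : N.graph.Adj (f y) (f z) ↔ N'.graph.Adj y z := by
    refine ⟨fun ha => ?_, h.hom _ _⟩
    rcases hy with rfl | hy <;> rcases hz with rfl | hz
    · exact (ha.ne rfl).elim
    · exact hz
    · exact hy.symm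
    · exact h.triangle _ _ hy hz ha
  by_cases ha : N'.graph.Adj y z
  · simp [hadj, ha, h.port _ _ ha]
  · simp [hadj, ha]

end IsLocalIsoAt

/-! ### Following port numbers, in a network and in a label -/

section Follow

variable {N : Network} (δ : PortNumbering N)

/-- The vertex reached from `x` through the given ports. -/
noncomputable def follow : N.V → List ℕ → Option N.V
  | x, [] => some x
  | x, q :: l => (neighborAt δ x q).bind fun y => follow y l

theorem follow_append (x : N.V) (l l' : List ℕ) :
    follow δ x (l ++ l') = (follow δ x l).bind fun y => follow δ y l' := by
  induction l generalizing x with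
  | nil => rfl
  | cons q l ih =>
    simp only [List.cons_append, follow, Option.bind_assoc]
    congr 1
    funext y
    exact ih y

/-- The sequence of port numbers of a walk. -/
def portWord : ∀ {u v : N.V}, N.graph.Walk u v → List ℕ
  | _, _, .nil => []
  | u, _, .cons (v := v) _ p => δ.port u v :: portWord p

theorem portWord_append {u v w : N.V} (p : N.graph.Walk u v) (q : N.graph.Walk v w) :
    portWord δ (p.append q) = portWord δ p ++ portWord δ q := by
  induction p with
  | nil => rfl
  | cons h p ih => simp [portWord, ih]

end Follow

/-- The number, in a label, of the neighbour of vertex number `i` to which port `q` leads. -/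
def traceStep (ℓ : BallLabel) (o : Option ℕ) (q : ℕ) : Option ℕ :=
  o.bind fun i => ℓ[i]?.bind fun row =>
    if row.idxOf (some q) < row.length then some (row.idxOf (some q)) else none

/-- The number, in a label, of the vertex reached from the root through the given ports, `none` if
this path leaves the ball. -/
def trace (ℓ : BallLabel) (l : List ℕ) : Option ℕ := l.foldl (traceStep ℓ) (some 0)

section Trace

variable {N : Network} (δ : PortNumbering N) {u : N.V}

theorem label_getElem? (i : ℕ) :
    (label δ u)[i]? = ((ballList δ u)[i]?).map fun x => (ballList δ u).map fun y =>
      open Classical in if N.graph.Adj x y then some (δ.port x y) else none := by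
  simp [label]

theorem traceStep_sound {i j q : ℕ} (h : traceStep (label δ u) (some i) q = some j) :
    ∃ y z, (ballList δ u)[i]? = some y ∧ (ballList δ u)[j]? = some z ∧
      neighborAt δ y q = some z := by
  classical
  simp only [traceStep, Option.bind_some, label_getElem?, Option.bind_eq_some_iff,
    Option.map_eq_some_iff] at h
  obtain ⟨_, ⟨y, hy, rfl⟩, h⟩ := h
  split_ifs at h with hlt
  obtain rfl := Option.some.inj h
  have hget := List.getElem?_eq_getElem hlt
  rw [List.getElem_idxOf hlt, List.getElem?_map, Option.map_eq_some_iff] at hget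
  obtain ⟨z, hz, hport⟩ := hget
  split_ifs at hport with hadj
  exact ⟨y, z, hy, hz, (neighborAt_eq_some δ).2 ⟨hadj, Option.some.inj hport⟩⟩

/-- The search returns some column holding this port. Ports at `y` are distinct and the ball lists
each vertex once, so that column is `j`. -/
theorem traceStep_complete {i j : ℕ} {y z : N.V} (hy : (ballList δ u)[i]? = some y)
    (hz : (ballList δ u)[j]? = some z) (h : N.graph.Adj y z) :
    traceStep (label δ u) (some i) (δ.port y z) = some j := by
  classical
  have hlt : (List.idxOf (some (δ.port y z)) ((ballList δ u).map fun x =>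
      if N.graph.Adj y x then some (δ.port y x) else none)) <
      ((ballList δ u).map fun x =>
        if N.graph.Adj y x then some (δ.port y x) else none).length := by
    rw [List.idxOf_lt_length_iff, List.mem_map]
    exact ⟨z, List.mem_of_getElem? hz, by simp [h]⟩
  have hs : traceStep (label δ u) (some i) (δ.port y z) =
      some (List.idxOf (some (δ.port y z)) ((ballList δ u).map fun x =>
      if N.graph.Adj y x then some (δ.port y x) else none)) := by
    simp only [traceStep, Option.bind_some, label_getElem?, hy, Option.map_some]
    rw [if_pos hlt]
  rw [hs]
  obtain ⟨y', z', hy', hz', hn⟩ := traceStep_sound δ hs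
  obtain rfl : y = y' := Option.some.inj (hy.symm.trans hy')
  rw [neighborAt_port δ h] at hn
  obtain rfl := Option.some.inj hn
  congr 1
  rw [List.getElem?_eq_some_iff] at hz hz'
  obtain ⟨h1, e1⟩ := hz
  obtain ⟨h2, e2⟩ := hz'
  exact (nodup_ballList δ u).getElem_inj_iff.1 (e2.trans e1.symm)

theorem foldl_traceStep_none (ℓ : BallLabel) (l : List ℕ) : l.foldl (traceStep ℓ) none = none := by
  induction l with
  | nil => rfl
  | cons q l ih => exact ih

theorem foldl_traceStep_sound {l : List ℕ} {i j : ℕ} {y : N.V} (hy : (ballList δ u)[i]? = some y)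
    (h : l.foldl (traceStep (label δ u)) (some i) = some j) :
    ∃ z, (ballList δ u)[j]? = some z ∧ follow δ y l = some z := by
  induction l generalizing i y with
  | nil => exact ⟨y, by simpa using (Option.some.inj h) ▸ hy, rfl⟩
  | cons q l ih =>
    rw [List.foldl_cons] at h
    cases hs : traceStep (label δ u) (some i) q with
    | none => simp [hs, foldl_traceStep_none] at h
    | some k =>
      rw [hs] at h
      obtain ⟨y', z', hy', hz', hn⟩ := traceStep_sound δ hs
      obtain rfl : y = y' := Option.some.inj (hy.symm.trans hy')
      obtain ⟨z, hz, hf⟩ := ih hz' h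
      exact ⟨z, hz, by simpa [follow, hn] using hf⟩

/-- Paths in the ball that end at the same vertex according to the label do so in the network. -/
theorem follow_eq_of_trace_eq {l l' : List ℕ} {j : ℕ} (h : trace (label δ u) l = some j)
    (h' : trace (label δ u) l' = some j) : follow δ u l = follow δ u l' := by
  obtain ⟨z, hz, hf⟩ := foldl_traceStep_sound δ (y := u) (by simp [ballList]) h
  obtain ⟨z', hz', hf'⟩ := foldl_traceStep_sound δ (y := u) (by simp [ballList]) h'
  rw [hf, hf', ← hz, ← hz']

theorem foldl_traceStep_complete {v y : N.V} (p : N.graph.Walk y v)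
    (hp : ∀ x ∈ p.support, x ∈ ballList δ u) {i j : ℕ} (hi : (ballList δ u)[i]? = some y)
    (hj : (ballList δ u)[j]? = some v) :
    (portWord δ p).foldl (traceStep (label δ u)) (some i) = some j := by
  induction p generalizing i with
  | nil =>
    rw [List.getElem?_eq_some_iff] at hi hj
    obtain ⟨h1, e1⟩ := hi
    obtain ⟨h2, e2⟩ := hj
    exact congrArg some ((nodup_ballList δ u).getElem_inj_iff.1 (e1.trans e2.symm))
  | cons h p ih =>
    obtain ⟨k, hk⟩ := List.mem_iff_getElem?.1 (hp _ (List.mem_cons_of_mem _ p.start_mem_support))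
    rw [portWord, List.foldl_cons, traceStep_complete δ hi hk h]
    exact ih (fun x hx => hp x (List.mem_cons_of_mem _ hx)) hk hj

theorem trace_portWord {v : N.V} (p : N.graph.Walk u v)
    (hp : ∀ x ∈ p.support, x = u ∨ N.graph.Adj u x) {j : ℕ}
    (hj : (ballList δ u)[j]? = some v) : trace (label δ u) (portWord δ p) = some j :=
  foldl_traceStep_complete δ p (fun x hx => (mem_ballList δ).2 (hp x hx)) (by simp [ballList]) hj

end Trace

/-! ### Balls in the universal cover -/

section GraphBall

variable {W : Type} (H : SimpleGraph W) (r : W)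

/-- The vertices at distance at most `n` from `r`. -/
def graphBall : ℕ → Set W
  | 0 => {r}
  | n + 1 => graphBall n ∪ {y | ∃ x ∈ graphBall n, H.Adj x y}

theorem graphBall_mono : Monotone (graphBall H r) :=
  monotone_nat_of_le_succ fun _ => Set.subset_union_left

theorem root_mem_graphBall (n : ℕ) : r ∈ graphBall H r n :=
  graphBall_mono H r (Nat.zero_le n) rfl

variable {H r} in
theorem mem_graphBall_succ {n : ℕ} {x y : W} (hx : x ∈ graphBall H r n) (h : H.Adj x y) :
    y ∈ graphBall H r (n + 1) :=
  Or.inr ⟨x, hx, h⟩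

theorem finite_graphBall (hfin : ∀ x, (H.neighborSet x).Finite) (n : ℕ) :
    (graphBall H r n).Finite := by
  induction n with
  | zero => exact Set.finite_singleton r
  | succ n ih =>
    refine ih.union ((ih.biUnion fun x _ => hfin x).subset ?_)
    rintro y ⟨x, hx, h⟩
    exact Set.mem_biUnion hx h

theorem connected_graphBall (n : ℕ) : (H.induce (graphBall H r n)).Connected := by
  have key : ∀ k (hk : k ≤ n) x (hx : x ∈ graphBall H r k),
      (H.induce (graphBall H r n)).Reachable ⟨r, root_mem_graphBall H r n⟩
        ⟨x, graphBall_mono H r hk hx⟩ := by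
    intro k
    induction k with
    | zero =>
      rintro hk x rfl
      exact .refl _
    | succ k ih =>
      rintro hk x (hx | ⟨y, hy, h⟩)
      · exact ih (by omega) x hx
      · exact (ih (by omega) y hy).trans (SimpleGraph.Adj.reachable (by simpa using h))
  exact { preconnected := fun x y =>
            (key n le_rfl x x.2).symm.trans (key n le_rfl y y.2)
          nonempty := ⟨⟨r, root_mem_graphBall H r n⟩⟩ }

/-- A ball equal to the next one is closed under adjacency, hence is the whole connected graph; but
balls are finite. -/
theorem exists_notMem_graphBall [Infinite W] (hH : H.Connected)
    (hfin : ∀ x, (H.neighborSet x).Finite) (n : ℕ) :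
    ∃ x ∈ graphBall H r (n + 1), x ∉ graphBall H r n := by
  by_contra! hcon
  have hall : ∀ a b, H.Walk a b → a ∈ graphBall H r n → b ∈ graphBall H r n := by
    intro a b p
    induction p with
    | nil => exact id
    | cons h p ih => exact fun ha => ih (hcon _ (mem_graphBall_succ ha h))
  refine Set.infinite_univ ((finite_graphBall H r hfin n).subset fun x _ => ?_)
  obtain ⟨p⟩ := hH.preconnected r x
  exact hall _ _ p (root_mem_graphBall H r n)

end GraphBall

section CoverBall

variable {N : Network} (δ : PortNumbering N) (v₀ : N.V)

theorem finite_neighborSet_coverGraph (x : Cover N.graph v₀) :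
    ((coverGraph N.graph v₀).neighborSet x).Finite := by
  have := N.finite
  exact Set.Finite.of_finite_image (f := Sigma.fst) (Set.toFinite _)
    fun y hy z hz h => coverGraph_inj hy hz h

/-- The ball of radius `n` in the universal cover. -/
def coverBall (n : ℕ) : Network where
  V := graphBall (coverGraph N.graph v₀) (Cover.mk .nil) n
  finite := finite_graphBall _ _ (finite_neighborSet_coverGraph v₀) n
  graph := (coverGraph N.graph v₀).induce _
  connected := connected_graphBall _ _ n

/-- The port numbering lifted to a ball of the universal cover. -/
def coverBallPorts (n : ℕ) : PortNumbering (coverBall v₀ n) where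
  port x y := δ.port x.1.1 y.1.1
  injOn _ _ hy _ hz h :=
    Subtype.ext (coverGraph_inj hy hz (δ.injOn _ (coverGraph_hom hy) (coverGraph_hom hz) h))

/-- Strictly inside the ball all neighbours in the cover are still present. On the boundary `surj`
may fail, hence `k < n`. -/
theorem isLocalIsoAt_coverBall {n k : ℕ} (hk : k < n) (x : (coverBall v₀ n).V)
    (hx : x.1 ∈ graphBall (coverGraph N.graph v₀) (Cover.mk .nil) k) :
    IsLocalIsoAt (coverBallPorts δ v₀ n) δ (fun y : (coverBall v₀ n).V => y.1.1) x where
  hom _ _ h := coverGraph_hom h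
  port _ _ _ := rfl
  surj w h := by
    obtain ⟨y, hy, rfl⟩ := coverGraph_surj h
    exact ⟨⟨y, graphBall_mono _ _ hk (mem_graphBall_succ hx hy)⟩, hy, rfl⟩
  triangle _ _ hy hz h := coverGraph_triangle (x := x.1) hy hz h

/-- An agent cannot distinguish a network from a ball of its universal cover before it is close to
the boundary of the ball. -/
theorem run_coverBall (A : Agent) {n t : ℕ} (ht : t ≤ n) :
    (run A δ v₀ t = none ∧
      run A (coverBallPorts δ v₀ n) ⟨Cover.mk .nil, root_mem_graphBall _ _ _⟩ t = none) ∨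
    ∃ (m : A.Mem) (i : Option ℕ) (x : (coverBall v₀ n).V),
      x.1 ∈ graphBall (coverGraph N.graph v₀) (Cover.mk .nil) t ∧
      run A δ v₀ t = some ⟨m, x.1.1, i⟩ ∧
      run A (coverBallPorts δ v₀ n) ⟨Cover.mk .nil, root_mem_graphBall _ _ _⟩ t =
        some ⟨m, x, i⟩ := by
  induction t with
  | zero => exact Or.inr ⟨A.init, none, ⟨Cover.mk .nil, root_mem_graphBall _ _ _⟩, rfl, rfl, rfl⟩
  | succ t ih =>
    rcases ih (by omega) with ⟨h1, h2⟩ | ⟨m, i, x, hx, h1, h2⟩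
    · exact Or.inl ⟨by simp [run, h1], by simp [run, h2]⟩
    · have hiso := isLocalIsoAt_coverBall δ v₀ (Nat.lt_of_succ_le ht) x hx
      have hmap := fun q => hiso.map_neighborAt q
      simp only [run, h1, h2, Option.bind_some, Config.next]
      rw [hiso.label_eq]
      cases hs : A.step m (label (coverBallPorts δ v₀ n) x, i) with
      | none => exact Or.inl ⟨rfl, rfl⟩
      | some r =>
        right
        obtain ⟨q, m'⟩ := r
        have hstay : x.1 ∈ graphBall (coverGraph N.graph v₀) (Cover.mk .nil) (t + 1) :=
          graphBall_mono _ _ (Nat.le_succ t) hx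
        cases q with
        | none => exact ⟨m', i, x, hstay, rfl, rfl⟩
        | some q =>
          have hq := hmap q
          cases hn : neighborAt (coverBallPorts δ v₀ n) x q with
          | none =>
            rw [hn] at hq
            refine ⟨m', i, x, hstay, ?_, ?_⟩
            · simp [Config.advance, ← hq]
            · simp [Config.advance, hn]
          | some y =>
            rw [hn] at hq
            refine ⟨m', some (δ.port y.1.1 x.1.1), y,
              mem_graphBall_succ hx ((neighborAt_eq_some _).1 hn).1, ?_, ?_⟩
            · simp [Config.advance, ← hq]
            · simp [Config.advance, hn]; rfl

/-- An Exploration algorithm does not halt on a network whose universal cover is infinite. -/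
theorem finite_cover_of_halts {A : Agent} (hA : IsExplorationAlgorithm A) (h : Halts A δ v₀) :
    Finite (Cover N.graph v₀) := by
  by_contra hinf
  rw [not_finite_iff_infinite] at hinf
  obtain ⟨T, hT⟩ := h
  obtain ⟨y, hy, hyT⟩ := exists_notMem_graphBall (coverGraph N.graph v₀) (Cover.mk .nil)
    (coverGraph_connected v₀) (finite_neighborSet_coverGraph v₀) T
  have hhalt : run A (coverBallPorts δ v₀ (T + 1))
      ⟨Cover.mk .nil, root_mem_graphBall _ _ _⟩ T = none := by
    rcases run_coverBall δ v₀ A (Nat.le_succ T) with ⟨-, h2⟩ | ⟨m, i, x, -, h1, -⟩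
    · exact h2
    · simp [hT] at h1
  rcases hA _ (coverBallPorts δ v₀ (T + 1)) ⟨Cover.mk .nil, root_mem_graphBall _ _ _⟩ with
    ⟨-, hvis⟩ | hno
  · obtain ⟨t, c, hc, hpos⟩ := hvis ⟨y, hy⟩
    -- No configuration exists from time `T` on, so `y` was visited earlier and lies in the ball of
    -- radius `T`, contrary to its choice.
    have hlt : t < T := by
      by_contra! hle
      have : ∀ k, run A (coverBallPorts δ v₀ (T + 1))
          ⟨Cover.mk .nil, root_mem_graphBall _ _ _⟩ (T + k) = none := by
        intro k
        induction k with
        | zero => exact hhalt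
        | succ k ih => simp [run, ih]
      obtain ⟨k, rfl⟩ := Nat.exists_eq_add_of_le hle
      simp [this k] at hc
    rcases run_coverBall δ v₀ A (n := T + 1) (t := t) (by omega) with
      ⟨-, h2⟩ | ⟨m, i, x, hx, -, h2⟩
    · simp [h2] at hc
    · rw [h2] at hc
      obtain rfl := Option.some.inj hc
      obtain rfl : x = ⟨y, hy⟩ := hpos
      exact hyT (graphBall_mono _ _ hlt.le hx)
  · exact hno ⟨T, hhalt⟩

end CoverBall

/-- Every network has a port numbering. -/
theorem PortNumbering.nonempty (N : Network) : Nonempty (PortNumbering N) := by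
  have := N.finite
  obtain ⟨k, ⟨e⟩⟩ := Finite.exists_equiv_fin N.V
  exact ⟨⟨fun _ w => e w, fun _ _ _ _ _ h => e.injective (Fin.ext h)⟩⟩

theorem mem_FNT_of_halts {N : Network} {δ : PortNumbering N} {A : Agent}
    (hA : IsExplorationAlgorithm A) (h : ∀ v₀, Halts A δ v₀) : N ∈ FNT := by
  obtain ⟨v₀⟩ := N.connected.nonempty
  exact (mem_FNT_iff v₀).2 (finite_cover_of_halts δ v₀ hA (h v₀))

/-! ### The universal exploration algorithm -/

/-- An instruction `(op, k, l)` for the explorer. -/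
abbrev Instr : Type := ℕ × ℕ × List ℕ

/-- The state of the explorer within one attempt: `((left, right), (todo, seen))`.
* `left` is the path from the homebase to the current location, last edge first, each edge with its
  port numbers at both ends;
* `right` is a path from the current location to the vertex to be examined;
* `todo` holds the paths from the homebase to the vertices to be examined later;
* `seen` holds the paths from the homebase to the examined vertices. -/
abbrev Attempt : Type := (List (ℕ × ℕ) × List ℕ) × (List (List ℕ) × List (List (ℕ × ℕ)))

/-- The memory of the explorer: the number of the attempt, the instructions that remain, and the
state of the attempt. -/
abbrev Memory : Type := (ℕ × List Instr) × Attempt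

/-- The port numbers of a path, from its start. -/
def forth (left : List (ℕ × ℕ)) : List ℕ := (left.map Prod.fst).reverse

/-- The path taken backwards. -/
def back (left : List (ℕ × ℕ)) : List ℕ := left.map Prod.snd

/-- Go back along the last edge of `left`. -/
def moveLeft (s : Attempt) : Option ℕ × Attempt :=
  -- `List.casesOn` is the form to which `Primrec.list_casesOn` applies.
  List.casesOn s.1.1 (none, s) fun e l => (some e.2, ((l, e.1 :: s.1.2), s.2))

/-- Go along the first edge of `right`, whose port number at its other end is `k`. -/
def moveRight (k : ℕ) (ℓ : BallLabel) (s : Attempt) : Option ℕ × Attempt :=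
  List.casesOn s.1.2 (none, s) fun q r =>
    -- The return port `k` is a guess of the instruction; tracing `q` then `k` back to the root,
    -- which has number 0, confirms it.
    if trace ℓ [q, k] = some 0 then (some q, (((q, k) :: s.1.1, r), s.2)) else (none, s)

/-- Replace the first `k` edges of `right` by `l` if both paths stay in the current ball and have
the same end. -/
def rewriteRight (k : ℕ) (l : List ℕ) (ℓ : BallLabel) (s : Attempt) : Attempt :=
  -- Without the second condition, two paths that both leave the ball would count as having the same
  -- end.
  if trace ℓ (s.1.2.take k) = trace ℓ l ∧ trace ℓ l ≠ none then
    ((s.1.1, l ++ s.1.2.drop k), s.2) else s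

/-- Add the current location to `seen`, if it is new, and its neighbours to `todo`. -/
def examine (ℓ : BallLabel) (s : Attempt) : List (List ℕ) × List (List (ℕ × ℕ)) :=
  if s.2.2.idxOf s.1.1 < s.2.2.length then s.2 else
    -- The first row belongs to the root and lists its ports; the entry `none` of the root itself
    -- only adds the current path once more.
    (ℓ.headI.map (fun o => forth s.1.1 ++ o.toList) ++ s.2.1, s.1.1 :: s.2.2)

/-- At the end of `right`, examine the current location, and start for the next element of `todo`;
halt if there is none. -/
def accept (ℓ : BallLabel) (s : Attempt) : Option (Option ℕ × Attempt) :=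
  if s.1.2 = [] then
    List.casesOn (examine ℓ s).1 none fun w ws =>
      -- `w` starts at the homebase, so the path from here first goes home.
      some (none, ((s.1.1, back s.1.1 ++ w), (ws, (examine ℓ s).2)))
  else some (none, s)

/-- The execution of an instruction. -/
def execute (c : Instr) (ℓ : BallLabel) (s : Attempt) : Option (Option ℕ × Attempt) :=
  if c.1 = 0 then accept ℓ s
  else if c.1 = 1 then some (moveRight c.2.1 ℓ s)
  else if c.1 = 2 then some (moveLeft s)
  else some (none, rewriteRight c.2.1 c.2.2 ℓ s)

/-- The instructions of attempt number `n`. -/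
def program (n : ℕ) : List Instr := Denumerable.ofNat (List Instr) n

/-- The state at the beginning of an attempt. -/
def Attempt.init : Attempt := (([], []), ([], []))

/-- When the instructions are exhausted, return to the homebase and start the next attempt. -/
def retreat (n : ℕ) (s : Attempt) : Option ℕ × Memory :=
  if s.1.1 = [] then (none, ((n + 1, program (n + 1)), Attempt.init))
  else ((moveLeft s).1, ((n, []), (moveLeft s).2))

/-- The transition function of the explorer. -/
def explorerStep (m : Memory) (o : Observation) : Option (Option ℕ × Memory) :=
  List.casesOn m.1.2 (some (retreat m.1.1 m.2)) fun c cs =>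
    (execute c o.1 m.2).map fun r => (r.1, ((m.1.1, cs), r.2))

/-! ### Primitive recursiveness of the transition function -/

section Computability

open Primrec

theorem primrec_idxOf {α : Type} [Primcodable α] [BEq α] [LawfulBEq α] :
    Primrec₂ fun (a : α) (l : List α) => l.idxOf a := by
  classical
  convert list_idxOf (α := α) using 4

theorem primrec_traceStep : 
    Primrec fun x : BallLabel × Option ℕ × ℕ => traceStep x.1 x.2.1 x.2.2 := by
  unfold traceStep
  refine option_bind (fst.comp snd) ?_
  refine option_bind (list_getElem?.comp (fst.comp fst) snd) ?_
  have hidx : Primrec fun p : ((BallLabel × Option ℕ × ℕ) × ℕ) × List (Option ℕ) =>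
      p.2.idxOf (some p.1.1.2.2) :=
    primrec_idxOf.comp (option_some.comp (snd.comp (snd.comp (fst.comp fst)))) snd
  exact ite (nat_lt.comp hidx (list_length.comp snd)) (option_some.comp hidx) (const none)

theorem primrec_trace : Primrec₂ trace := by
  change Primrec fun x : BallLabel × List ℕ => x.2.foldl (fun o q => traceStep x.1 o q) (some 0)
  refine list_foldl (h := fun x b => traceStep x.1 b.1 b.2) snd (const (some 0)) ?_
  exact primrec_traceStep.comp (pair (fst.comp fst) snd)

theorem primrec_forth : Primrec forth := list_reverse.comp (list_map .id (fst.comp snd))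

theorem primrec_back : Primrec back := list_map .id (snd.comp snd)

theorem primrec_moveLeft : Primrec moveLeft := by
  refine list_casesOn (h := fun (s : Attempt) (e : (ℕ × ℕ) × List (ℕ × ℕ)) =>
      (some e.1.2, ((e.2, e.1.1 :: s.1.2), s.2)))
    (fst.comp fst) (pair (const (none : Option ℕ)) .id) ?_
  exact pair (option_some.comp (snd.comp (fst.comp snd)))
    (pair (pair (snd.comp snd)
      (list_cons.comp (fst.comp (fst.comp snd)) (snd.comp (fst.comp fst)))) (snd.comp fst))

theorem primrec_moveRight :
    Primrec fun x : ℕ × BallLabel × Attempt => moveRight x.1 x.2.1 x.2.2 := by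
  have hs : Primrec fun x : ℕ × BallLabel × Attempt => x.2.2 := snd.comp snd
  refine list_casesOn (h := fun x e => if trace x.2.1 [e.1, x.1] = some 0 then
      (some e.1, (((e.1, x.1) :: x.2.2.1.1, e.2), x.2.2.2)) else (none, x.2.2))
    (snd.comp (fst.comp hs)) (pair (const (none : Option ℕ)) hs) ?_
  have hq : Primrec fun y : (ℕ × BallLabel × Attempt) × ℕ × List ℕ => y.2.1 := fst.comp snd
  have hk : Primrec fun y : (ℕ × BallLabel × Attempt) × ℕ × List ℕ => y.1.1 := fst.comp fst
  have hs' : Primrec fun y : (ℕ × BallLabel × Attempt) × ℕ × List ℕ => y.1.2.2 := hs.comp fst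
  refine Primrec.ite (Primrec.eq.comp (primrec_trace.comp (fst.comp (snd.comp fst))
    (list_cons.comp hq (list_cons.comp hk (const ([] : List ℕ))))) (const (some 0))) ?_
    (pair (const (none : Option ℕ)) hs')
  exact pair (option_some.comp hq)
    (pair (pair (list_cons.comp (pair hq hk) (fst.comp (fst.comp hs'))) (snd.comp snd))
      (snd.comp hs'))

theorem primrec_rewriteRight : Primrec fun x : (ℕ × List ℕ) × BallLabel × Attempt =>
    rewriteRight x.1.1 x.1.2 x.2.1 x.2.2 := by
  have hs : Primrec fun x : (ℕ × List ℕ) × BallLabel × Attempt => x.2.2 := snd.comp snd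
  have hl : Primrec fun x : (ℕ × List ℕ) × BallLabel × Attempt => x.1.2 := snd.comp fst
  have hk : Primrec fun x : (ℕ × List ℕ) × BallLabel × Attempt => x.1.1 := fst.comp fst
  have hℓ : Primrec fun x : (ℕ × List ℕ) × BallLabel × Attempt => x.2.1 := fst.comp snd
  have hr : Primrec fun x : (ℕ × List ℕ) × BallLabel × Attempt => x.2.2.1.2 :=
    snd.comp (fst.comp hs)
  have htr := primrec_trace.comp hℓ hl
  refine Primrec.ite (PrimrecPred.and
    (Primrec.eq.comp (primrec_trace.comp hℓ (list_take.comp hk hr)) htr)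
    (PrimrecPred.not (Primrec.eq.comp htr (const none)))) ?_ hs
  exact pair (pair (fst.comp (fst.comp hs)) (list_append.comp hl (list_drop.comp hk hr)))
    (snd.comp hs)

theorem primrec_examine : Primrec₂ examine := by
  have hs : Primrec fun x : BallLabel × Attempt => x.2 := snd
  have hleft : Primrec fun x : BallLabel × Attempt => x.2.1.1 := fst.comp (fst.comp hs)
  have hseen : Primrec fun x : BallLabel × Attempt => x.2.2.2 := snd.comp (snd.comp hs)
  change Primrec fun x : BallLabel × Attempt =>
    if x.2.2.2.idxOf x.2.1.1 < x.2.2.2.length then x.2.2 else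
      (x.1.headI.map (fun o => forth x.2.1.1 ++ o.toList) ++ x.2.2.1, x.2.1.1 :: x.2.2.2)
  refine Primrec.ite (nat_lt.comp (primrec_idxOf.comp hleft hseen) (list_length.comp hseen))
    (snd.comp hs) ?_
  refine pair (list_append.comp (list_map (list_headI.comp fst) ?_) (fst.comp (snd.comp hs)))
    (list_cons.comp hleft hseen)
  exact list_append.comp (primrec_forth.comp (hleft.comp fst)) (optionToList.comp snd)

theorem primrec_accept : Primrec₂ accept := by
  have hs : Primrec fun x : BallLabel × Attempt => x.2 := snd
  change Primrec fun x : BallLabel × Attempt => accept x.1 x.2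
  refine Primrec.ite (Primrec.eq.comp (snd.comp (fst.comp hs)) (const [])) ?_
    (option_some.comp (pair (const (none : Option ℕ)) hs))
  have hex : Primrec fun x : BallLabel × Attempt => examine x.1 x.2 := primrec_examine
  refine list_casesOn (h := fun (x : BallLabel × Attempt) (e : List ℕ × List (List ℕ)) =>
      some ((none : Option ℕ), ((x.2.1.1, back x.2.1.1 ++ e.1), (e.2, (examine x.1 x.2).2))))
    (fst.comp hex) (const none) ?_
  have hleft : Primrec fun y : (BallLabel × Attempt) × List ℕ × List (List ℕ) => y.1.2.1.1 :=
    fst.comp (fst.comp (hs.comp fst))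
  exact option_some.comp (pair (const (none : Option ℕ))
    (pair (pair hleft (list_append.comp (primrec_back.comp hleft) (fst.comp snd)))
      (pair (snd.comp snd) (snd.comp (hex.comp fst)))))

theorem primrec_execute :
    Primrec fun x : Instr × BallLabel × Attempt => execute x.1 x.2.1 x.2.2 := by
  have hop : Primrec fun x : Instr × BallLabel × Attempt => x.1.1 := fst.comp fst
  refine Primrec.ite (Primrec.eq.comp hop (const 0))
    (primrec_accept.comp (fst.comp snd) (snd.comp snd)) ?_
  refine Primrec.ite (Primrec.eq.comp hop (const 1)) (option_some.comp
    (primrec_moveRight.comp (pair (fst.comp (snd.comp fst)) snd))) ?_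
  refine Primrec.ite (Primrec.eq.comp hop (const 2)) (option_some.comp
    (primrec_moveLeft.comp (snd.comp snd))) ?_
  exact option_some.comp (pair (const (none : Option ℕ))
    (primrec_rewriteRight.comp (pair (snd.comp fst) snd)))

theorem primrec_retreat : Primrec₂ retreat := by
  change Primrec fun x : ℕ × Attempt => retreat x.1 x.2
  have hn : Primrec fun x : ℕ × Attempt => x.1 := fst
  have hs : Primrec fun x : ℕ × Attempt => x.2 := snd
  have hm : Primrec fun x : ℕ × Attempt => moveLeft x.2 := primrec_moveLeft.comp hs
  refine Primrec.ite (Primrec.eq.comp (fst.comp (fst.comp hs)) (const [])) ?_ ?_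
  · exact pair (const none) (pair (pair (succ.comp hn) ((Primrec.ofNat (List Instr)).comp
      (succ.comp hn))) (const _))
  · exact pair (fst.comp hm) (pair (pair hn (const [])) (snd.comp hm))

theorem primrec_execute_comp {α : Type} [Primcodable α] {c : α → Instr} {ℓ : α → BallLabel}
    {s : α → Attempt} (hc : Primrec c) (hℓ : Primrec ℓ) (hs : Primrec s) :
    Primrec fun a => execute (c a) (ℓ a) (s a) :=
  primrec_execute.comp (pair hc (pair hℓ hs))

theorem primrec_resume {A P : Type} [Primcodable A] [Primcodable P] {α : Type} [Primcodable α]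
    {n : α → ℕ} {cs : α → List Instr} {e : α → Option (P × A)} (hn : Primrec n)
    (hcs : Primrec cs) (he : Primrec e) :
    Primrec fun a => (e a).map fun r => (r.1, ((n a, cs a), r.2)) := by
  have h1 : Primrec fun z : α × (P × A) => (n z.1, cs z.1) := pair (hn.comp fst) (hcs.comp fst)
  have h2 : Primrec fun z : α × (P × A) => z.2.1 := fst.comp snd
  have h3 : Primrec fun z : α × (P × A) => z.2.2 := snd.comp snd
  exact option_map he (pair h2 (pair h1 h3))

/-- A single step involves no search; the unbounded search consists in the succession of attempts.
-/
theorem primrec_explorerStep : Primrec₂ explorerStep := by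
  have hs : Primrec fun x : Memory × Observation => x.1.2 := snd.comp fst
  have hp : Primrec fun x : Memory × Observation => x.1.1 := fst.comp fst
  have hn : Primrec fun x : Memory × Observation => x.1.1.1 := fst.comp hp
  have hcs : Primrec fun x : Memory × Observation => x.1.1.2 := snd.comp hp
  have hℓ : Primrec fun x : Memory × Observation => x.2.1 := fst.comp snd
  have hret : Primrec fun x : Memory × Observation => some (retreat x.1.1.1 x.1.2) :=
    option_some.comp (primrec_retreat.comp hn hs)
  have hc : Primrec fun y : (Memory × Observation) × Instr × List Instr => y.2.1 := fst.comp snd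
  have hcs' : Primrec fun y : (Memory × Observation) × Instr × List Instr => y.2.2 := snd.comp snd
  have hn' : Primrec fun y : (Memory × Observation) × Instr × List Instr => y.1.1.1.1 :=
    hn.comp fst
  have hex : Primrec fun y : (Memory × Observation) × Instr × List Instr =>
      execute y.2.1 y.1.2.1 y.1.1.2 := primrec_execute_comp hc (hℓ.comp fst) (hs.comp fst)
  have hres : Primrec₂ fun (x : Memory × Observation) (e : Instr × List Instr) =>
      (execute e.1 x.2.1 x.1.2).map fun r => (r.1, ((x.1.1.1, e.2), r.2)) :=
    primrec_resume hn' hcs' hex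
  have := list_casesOn hcs hret hres
  exact this

end Computability

/-- The universal exploration algorithm. -/
def explorer : Agent where
  Mem := Memory
  primcodable := inferInstance
  init := ((0, program 0), Attempt.init)
  step := explorerStep
  computable := primrec_explorerStep.to_comp

/-! ### The explorer halts only when it has visited every vertex -/

section Soundness

variable {N : Network} (δ : PortNumbering N) (v₀ : N.V)

/-- `Leads δ v₀ l x`: the path `l` goes from `v₀` to `x`. -/
def Leads : List (ℕ × ℕ) → N.V → Prop
  | [], x => x = v₀
  | e :: l, x => ∃ y, Leads l y ∧ neighborAt δ y e.1 = some x ∧ neighborAt δ x e.2 = some y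

variable {δ v₀}

theorem Leads.follow_forth {l : List (ℕ × ℕ)} {x : N.V} (h : Leads δ v₀ l x) :
    follow δ v₀ (forth l) = some x := by
  induction l generalizing x with
  | nil => exact congrArg some (Eq.symm h)
  | cons e l ih =>
    obtain ⟨y, hy, h1, -⟩ := h
    have hf : forth (e :: l) = forth l ++ [e.1] := by simp [forth]
    rw [hf, follow_append, ih hy]
    simp [follow, h1]

theorem Leads.follow_back {l : List (ℕ × ℕ)} {x : N.V} (h : Leads δ v₀ l x) :
    follow δ x (back l) = some v₀ := by
  induction l generalizing x with
  | nil => exact congrArg some h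
  | cons e l ih =>
    obtain ⟨y, hy, -, h2⟩ := h
    have hb : back (e :: l) = e.2 :: back l := rfl
    rw [hb, follow, h2]
    exact ih hy

theorem Leads.unique {l : List (ℕ × ℕ)} {x y : N.V} (hx : Leads δ v₀ l x)
    (hy : Leads δ v₀ l y) : x = y :=
  Option.some.inj (hx.follow_forth.symm.trans hy.follow_forth)

variable (δ) in
/-- Where port `p` leads; an unused port leads nowhere. -/
noncomputable def dest (x : N.V) (p : Option ℕ) : N.V := (p.bind (neighborAt δ x)).getD x

theorem exists_next_eq {m m' : Memory} {x : N.V} {i p : Option ℕ}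
    (h : explorerStep m (label δ x, i) = some (p, m')) :
    ∃ i', Config.next explorer δ ⟨m, x, i⟩ = some ⟨m', dest δ x p, i'⟩ := by
  have hs : explorer.step m (label δ x, i) = some (p, m') := h
  have hn : Config.next explorer δ ⟨m, x, i⟩ =
      some (Config.advance explorer δ ⟨m, x, i⟩ p m') := by
    rw [Config.next, hs]
    rfl
  rw [hn]
  unfold Config.advance dest
  cases p.bind (neighborAt δ x) with
  | none => exact ⟨_, rfl⟩
  | some w => exact ⟨_, rfl⟩

variable (δ v₀) in
/-- The invariant of the explorer at `x` when the vertices in `S` have been visited. -/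
structure Sound (S : Set N.V) (s : Attempt) (x : N.V) : Prop where
  left : Leads δ v₀ s.1.1 x
  seen : ∀ l ∈ s.2.2, ∃ y ∈ S, Leads δ v₀ l y
  closed : ∀ l ∈ s.2.2, ∀ y, Leads δ v₀ l y → ∀ z, N.graph.Adj y z →
    (∃ l' ∈ s.2.2, Leads δ v₀ l' z) ∨ follow δ x s.1.2 = some z ∨
      ∃ w ∈ s.2.1, follow δ v₀ w = some z

theorem Sound.init (S : Set N.V) : Sound δ v₀ S Attempt.init v₀ :=
  ⟨rfl, by simp [Attempt.init], by simp [Attempt.init]⟩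

variable {S : Set N.V} {x : N.V}

/-- Only the end of `right` enters the invariant, and a move along the path does not change it. -/
theorem Sound.moveLeft {s : Attempt} (h : Sound δ v₀ S s x) :
    Sound δ v₀ S (moveLeft s).2 (dest δ x (moveLeft s).1) := by
  obtain ⟨⟨left, right⟩, todo, seen⟩ := s
  cases left with
  | nil => exact h
  | cons e l =>
    obtain ⟨y, hy, h1, h2⟩ := h.left
    have hd : dest δ x (Binoculars.moveLeft ((e :: l, right), todo, seen)).1 = y := by
      simp [Binoculars.moveLeft, dest, h2]
    rw [hd]
    refine ⟨hy, h.seen, fun l' hl' y' hy' z hz => ?_⟩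
    rcases h.closed l' hl' y' hy' z hz with h3 | h3 | h3
    · exact Or.inl h3
    · refine Or.inr (Or.inl ?_)
      simpa [Binoculars.moveLeft, follow, h1] using h3
    · exact Or.inr (Or.inr h3)

theorem follow_of_trace_eq_zero {l : List ℕ} (h : trace (label δ x) l = some 0) :
    follow δ x l = some x :=
  follow_eq_of_trace_eq δ h (l' := []) rfl

theorem Sound.moveRight {s : Attempt} (h : Sound δ v₀ S s x) (k : ℕ) :
    Sound δ v₀ S (moveRight k (label δ x) s).2 (dest δ x (moveRight k (label δ x) s).1) := by
  obtain ⟨⟨left, right⟩, todo, seen⟩ := s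
  cases right with
  | nil => exact h
  | cons q r =>
    by_cases ht : trace (label δ x) [q, k] = some 0
    · have hm : Binoculars.moveRight k (label δ x) ((left, q :: r), todo, seen) =
          (some q, (((q, k) :: left, r), (todo, seen))) := by
        simp [Binoculars.moveRight, ht]
      have hf := follow_of_trace_eq_zero ht
      simp only [follow, Option.bind_eq_some_iff, Option.some.injEq] at hf
      obtain ⟨y, hy, x', hx, rfl⟩ := hf
      have hd : dest δ x' (some q) = y := by simp [dest, hy]
      rw [hm, hd]
      refine ⟨⟨x', h.left, hy, hx⟩, h.seen, fun l' hl' y' hy' z hz => ?_⟩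
      rcases h.closed l' hl' y' hy' z hz with h3 | h3 | h3
      · exact Or.inl h3
      · refine Or.inr (Or.inl ?_)
        simpa [follow, hy] using h3
      · exact Or.inr (Or.inr h3)
    · have hm : Binoculars.moveRight k (label δ x) ((left, q :: r), todo, seen) =
          (none, ((left, q :: r), todo, seen)) := by
        simp [Binoculars.moveRight, ht]
      rw [hm]
      exact h

/-- Paths traced to the same number in the label have the same end in the network, so the end of
`right` is kept. -/
theorem Sound.rewriteRight {s : Attempt} (h : Sound δ v₀ S s x) (k : ℕ) (l : List ℕ) :
    Sound δ v₀ S (rewriteRight k l (label δ x) s) x := by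
  unfold Binoculars.rewriteRight
  split_ifs with ht
  · refine ⟨h.left, h.seen, fun l' hl' y' hy' z hz => ?_⟩
    rcases h.closed l' hl' y' hy' z hz with h3 | h3 | h3
    · exact Or.inl h3
    · refine Or.inr (Or.inl ?_)
      obtain ⟨j, hj⟩ := Option.ne_none_iff_exists'.1 ht.2
      rw [← List.take_append_drop k s.1.2, follow_append,
        follow_eq_of_trace_eq δ (ht.1.trans hj) hj] at h3
      rw [follow_append]
      exact h3
    · exact Or.inr (Or.inr h3)
  · exact h

theorem mem_headI_label {z : N.V} (h : N.graph.Adj x z) :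
    some (δ.port x z) ∈ (label δ x).headI := by
  classical
  simp only [label, ballList, List.map_cons, List.headI_cons, List.mem_cons, List.mem_map]
  refine Or.inr ⟨z, ?_, by simp [h]⟩
  have := (mem_ballList δ).2 (Or.inr h)
  simpa [ballList, h.ne'] using this

/-- After the examination of the end of `right`, the neighbours of the examined vertices are
examined or listed in `todo`. -/
theorem Sound.examine {s : Attempt} (h : Sound δ v₀ S s x) (hx : x ∈ S) (hr : s.1.2 = []) :
    s.1.1 ∈ (examine (label δ x) s).2 ∧
    (∀ l ∈ (examine (label δ x) s).2, ∃ y ∈ S, Leads δ v₀ l y) ∧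
    ∀ l ∈ (examine (label δ x) s).2, ∀ y, Leads δ v₀ l y → ∀ z, N.graph.Adj y z →
      (∃ l' ∈ (examine (label δ x) s).2, Leads δ v₀ l' z) ∨
        ∃ w ∈ (examine (label δ x) s).1, follow δ v₀ w = some z := by
  obtain ⟨⟨left, right⟩, todo, seen⟩ := s
  obtain rfl : right = [] := hr
  by_cases hmem : left ∈ seen
  · have he : Binoculars.examine (label δ x) ((left, []), todo, seen) = (todo, seen) :=
      if_pos (List.idxOf_lt_length_iff.2 hmem)
    rw [he]
    refine ⟨hmem, h.seen, fun l hl y hy z hz => ?_⟩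
    rcases h.closed l hl y hy z hz with h3 | h3 | h3
    · exact Or.inl h3
    · refine Or.inl ⟨left, hmem, ?_⟩
      obtain rfl := Option.some.inj h3
      exact h.left
    · exact Or.inr h3
  · have he : Binoculars.examine (label δ x) ((left, []), todo, seen) =
        ((label δ x).headI.map (fun o => forth left ++ o.toList) ++ todo, left :: seen) := by
      simp [Binoculars.examine, hmem]
    rw [he]
    refine ⟨List.mem_cons_self, ?_, fun l hl y hy z hz => ?_⟩
    · intro l hl
      rcases List.mem_cons.1 hl with rfl | hl
      · exact ⟨x, hx, h.left⟩
      · exact h.seen l hl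
    · rcases List.mem_cons.1 hl with rfl | hl
      · obtain rfl := Leads.unique hy h.left
        refine Or.inr ⟨forth l ++ [δ.port y z], ?_, ?_⟩
        · exact List.mem_append_left _ (List.mem_map.2 ⟨_, mem_headI_label hz, rfl⟩)
        · rw [follow_append, hy.follow_forth]
          simp [follow, neighborAt_port δ hz]
      · rcases h.closed l hl y hy z hz with ⟨l', hl', h3⟩ | h3 | ⟨w, hw, h3⟩
        · exact Or.inl ⟨l', List.mem_cons_of_mem _ hl', h3⟩
        · obtain rfl := Option.some.inj h3
          exact Or.inl ⟨left, List.mem_cons_self, h.left⟩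
        · exact Or.inr ⟨w, List.mem_append_right _ hw, h3⟩

/-- With `todo` empty, the ends of the paths in `seen` are closed under adjacency and include `x`;
by connectedness they are all vertices, and they lie in `S`. -/
theorem Sound.accept {s : Attempt} (h : Sound δ v₀ S s x) (hx : x ∈ S) :
    (accept (label δ x) s = none ∧ ∀ w, w ∈ S) ∨
      ∃ p s', accept (label δ x) s = some (p, s') ∧ Sound δ v₀ S s' (dest δ x p) := by
  by_cases hr : s.1.2 = []
  · obtain ⟨h1, h2, h3⟩ := h.examine hx hr
    simp only [Binoculars.accept, if_pos hr]
    cases he : (Binoculars.examine (label δ x) s).1 with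
    | nil =>
      refine Or.inl ⟨rfl, fun w => ?_⟩
      suffices ∀ a b, N.graph.Walk a b →
          (∃ l ∈ (Binoculars.examine (label δ x) s).2, Leads δ v₀ l a) →
          ∃ l ∈ (Binoculars.examine (label δ x) s).2, Leads δ v₀ l b by
        obtain ⟨p⟩ := N.connected.preconnected x w
        obtain ⟨l, hl, hw⟩ := this _ _ p ⟨_, h1, h.left⟩
        obtain ⟨y, hy, hly⟩ := h2 l hl
        exact Leads.unique hw hly ▸ hy
      intro a b p
      induction p with
      | nil => exact id
      | cons hadj p ih =>
        rintro ⟨l, hl, ha⟩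
        refine ih ?_
        rcases h3 l hl _ ha _ hadj with h4 | ⟨w, hw, -⟩
        · exact h4
        · simp [he] at hw
    | cons w ws =>
      refine Or.inr ⟨_, _, rfl, h.left, h2, fun l hl y hy z hz => ?_⟩
      rcases h3 l hl y hy z hz with h4 | ⟨w', hw', h4⟩
      · exact Or.inl h4
      · rw [he] at hw'
        rcases List.mem_cons.1 hw' with rfl | hw'
        · refine Or.inr (Or.inl ?_)
          change follow δ x (back s.1.1 ++ w') = some z
          rw [follow_append, h.left.follow_back]
          exact h4
        · exact Or.inr (Or.inr ⟨w', hw', h4⟩)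
  · exact Or.inr ⟨none, s, by simp [Binoculars.accept, hr], h⟩

theorem Sound.execute {s : Attempt} (h : Sound δ v₀ S s x) (hx : x ∈ S) (c : Instr) :
    (execute c (label δ x) s = none ∧ ∀ w, w ∈ S) ∨
      ∃ p s', execute c (label δ x) s = some (p, s') ∧ Sound δ v₀ S s' (dest δ x p) := by
  unfold Binoculars.execute
  split_ifs
  · exact h.accept hx
  · exact Or.inr ⟨_, _, rfl, h.moveRight _⟩
  · exact Or.inr ⟨_, _, rfl, h.moveLeft⟩
  · exact Or.inr ⟨_, _, rfl, h.rewriteRight _ _⟩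

/-- An empty `left` certifies that the agent is at the homebase, where a fresh attempt may begin. -/
theorem Sound.retreat {s : Attempt} (h : Sound δ v₀ S s x) (n : ℕ) :
    Sound δ v₀ S (retreat n s).2.2 (dest δ x (retreat n s).1) := by
  unfold Binoculars.retreat
  split_ifs with hl
  · have hx : x = v₀ := by simpa [hl, Leads] using h.left
    subst hx
    exact Sound.init S
  · exact h.moveLeft

theorem Sound.step {m : Memory} (h : Sound δ v₀ S m.2 x) (hx : x ∈ S) (i : Option ℕ) :
    (explorerStep m (label δ x, i) = none ∧ ∀ w, w ∈ S) ∨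
      ∃ p m', explorerStep m (label δ x, i) = some (p, m') ∧ Sound δ v₀ S m'.2 (dest δ x p) := by
  obtain ⟨⟨n, cs⟩, s⟩ := m
  cases cs with
  | nil => exact Or.inr ⟨_, _, rfl, h.retreat n⟩
  | cons c cs =>
    rcases h.execute hx c with ⟨he, hS⟩ | ⟨p, s', he, hs⟩
    · left
      exact ⟨by simp [explorerStep, he], hS⟩
    · right
      exact ⟨p, ((n, cs), s'), by simp [explorerStep, he], hs⟩

/-- `S` is the set of vertices visited at any time of the run, so it stays fixed during the
induction and always contains the current position. -/
theorem sound_run {t : ℕ} {c : Config explorer N} (h : run explorer δ v₀ t = some c) :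
    Sound δ v₀ {w | Visits explorer δ v₀ w} (Prod.snd (α := ℕ × List Instr) c.mem) c.pos := by
  induction t generalizing c with
  | zero =>
    obtain rfl := Option.some.inj h
    exact Sound.init _
  | succ t ih =>
    rw [run, Option.bind_eq_some_iff] at h
    obtain ⟨⟨m, x, i⟩, hc, hnext⟩ := h
    rcases (ih hc).step ⟨t, _, hc, rfl⟩ i with ⟨he, -⟩ | ⟨p, m', he, hs⟩
    · have : explorer.step m (label δ x, i) = none := he
      simp [Config.next, this] at hnext
    · obtain ⟨i', hi'⟩ := exists_next_eq he
      obtain rfl := Option.some.inj (hi'.symm.trans hnext)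
      exact hs

theorem isExplorationAlgorithm_explorer : IsExplorationAlgorithm explorer := by
  intro N δ v₀
  by_cases h : Halts explorer δ v₀
  · refine Or.inl ⟨h, ?_⟩
    obtain ⟨t, ht⟩ := h
    induction t with
    | zero => simp [run] at ht
    | succ t ih =>
      cases hc : run explorer δ v₀ t with
      | none => exact ih hc
      | some c =>
        obtain ⟨m, x, i⟩ := c
        rcases (sound_run hc).step ⟨t, _, hc, rfl⟩ i with ⟨-, hS⟩ | ⟨p, m', he, -⟩
        · exact hS
        · obtain ⟨i', hi'⟩ := exists_next_eq he
          simp [run, hc, hi'] at ht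
  · exact Or.inr h

end Soundness

/-! ### The explorer halts if the universal cover is finite -/

section Completeness

variable {N : Network} (δ : PortNumbering N)

/-- The explorer gets from `c` to `c'`. -/
def Reach : Config explorer N → Config explorer N → Prop :=
  Relation.ReflTransGen fun c c' => Config.next explorer δ c = some c'

/-- The explorer halts when it is started in the state `c`. -/
def HaltsFrom (c : Config explorer N) : Prop :=
  ∃ c', Reach δ c c' ∧ Config.next explorer δ c' = none

variable {δ}

theorem Reach.haltsFrom {c c' : Config explorer N} (h : Reach δ c c') (h' : HaltsFrom δ c') :
    HaltsFrom δ c := by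
  obtain ⟨d, hd, hn⟩ := h'
  exact ⟨d, Relation.ReflTransGen.trans h hd, hn⟩

theorem HaltsFrom.halts {v₀ : N.V} (h : HaltsFrom δ ⟨explorer.init, v₀, none⟩) :
    Halts explorer δ v₀ := by
  obtain ⟨c, hc, hn⟩ := h
  have : ∃ t, run explorer δ v₀ t = some c := by
    clear hn
    induction hc with
    | refl => exact ⟨0, rfl⟩
    | tail _ hstep ih =>
      obtain ⟨t, ht⟩ := ih
      exact ⟨t + 1, by simp [run, ht, hstep]⟩
  obtain ⟨t, ht⟩ := this
  exact ⟨t + 1, by simp [run, ht, hn]⟩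

theorem reach_of_step {m m' : Memory} {x : N.V} {i p : Option ℕ}
    (h : explorerStep m (label δ x, i) = some (p, m')) :
    ∃ i', Reach δ ⟨m, x, i⟩ ⟨m', dest δ x p, i'⟩ := by
  obtain ⟨i', hi'⟩ := exists_next_eq h
  exact ⟨i', Relation.ReflTransGen.single hi'⟩

theorem haltsFrom_of_step {m : Memory} {x : N.V} {i : Option ℕ}
    (h : explorerStep m (label δ x, i) = none) : HaltsFrom δ ⟨m, x, i⟩ := by
  refine ⟨_, Relation.ReflTransGen.refl, ?_⟩
  have : explorer.step m (label δ x, i) = none := h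
  simp [Config.next, this]

variable (δ) in
/-- Some instructions lead from the state `s` at `x` to the state `s'` at `x'`. -/
def Trans (s : Attempt) (x : N.V) (s' : Attempt) (x' : N.V) : Prop :=
  ∃ cs : List Instr, ∀ n rest i, ∃ i',
    Reach δ ⟨((n, cs ++ rest), s), x, i⟩ ⟨((n, rest), s'), x', i'⟩

variable (δ) in
/-- Some instructions make the explorer halt from the state `s` at `x`. -/
def CanHalt (s : Attempt) (x : N.V) : Prop :=
  ∃ cs : List Instr, ∀ n rest i, HaltsFrom δ ⟨((n, cs ++ rest), s), x, i⟩

theorem Trans.refl (s : Attempt) (x : N.V) : Trans δ s x s x :=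
  ⟨[], fun _ _ i => ⟨i, Relation.ReflTransGen.refl⟩⟩

/-- Instruction lists can be concatenated because `Trans` is uniform in the attempt number, the
remaining instructions and the arrival port. -/
theorem Trans.trans {s s' s'' : Attempt} {x x' x'' : N.V} (h : Trans δ s x s' x')
    (h' : Trans δ s' x' s'' x'') : Trans δ s x s'' x'' := by
  obtain ⟨cs, h⟩ := h
  obtain ⟨cs', h'⟩ := h'
  refine ⟨cs ++ cs', fun n rest i => ?_⟩
  obtain ⟨i', h1⟩ := h n (cs' ++ rest) i
  obtain ⟨i'', h2⟩ := h' n rest i'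
  rw [List.append_assoc]
  exact ⟨i'', Relation.ReflTransGen.trans h1 h2⟩

theorem Trans.canHalt {s s' : Attempt} {x x' : N.V} (h : Trans δ s x s' x')
    (h' : CanHalt δ s' x') : CanHalt δ s x := by
  obtain ⟨cs, h⟩ := h
  obtain ⟨cs', h'⟩ := h'
  refine ⟨cs ++ cs', fun n rest i => ?_⟩
  obtain ⟨i', h1⟩ := h n (cs' ++ rest) i
  rw [List.append_assoc]
  exact Reach.haltsFrom h1 (h' n rest i')

theorem Trans.of_execute {s s' : Attempt} {x : N.V} {p : Option ℕ} (c : Instr)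
    (h : execute c (label δ x) s = some (p, s')) : Trans δ s x s' (dest δ x p) :=
  ⟨[c], fun n rest i => reach_of_step (by simp [explorerStep, h])⟩

theorem CanHalt.of_execute {s : Attempt} {x : N.V} (c : Instr)
    (h : execute c (label δ x) s = none) : CanHalt δ s x :=
  ⟨[c], fun n rest i => haltsFrom_of_step (by simp [explorerStep, h])⟩

variable (δ) in
/-- The stack of the port numbers, at both ends, of the edges of a walk, put on top of `l`. -/
def stack : ∀ {u v : N.V}, N.graph.Walk u v → List (ℕ × ℕ) → List (ℕ × ℕ)
  | _, _, .nil, l => l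
  | u, _, .cons (v := v) _ p, l => stack p ((δ.port u v, δ.port v u) :: l)

theorem forth_stack {u v : N.V} (p : N.graph.Walk u v) (l : List (ℕ × ℕ)) :
    forth (stack δ p l) = forth l ++ portWord δ p := by
  induction p generalizing l with
  | nil => simp [stack, portWord]
  | cons h p ih => rw [stack, portWord, ih]; simp [forth]

theorem back_stack {u v : N.V} (p : N.graph.Walk u v) (l : List (ℕ × ℕ)) :
    back (stack δ p l) = portWord δ p.reverse ++ back l := by
  induction p generalizing l with
  | nil => simp [stack, portWord]
  | cons h p ih => rw [stack, ih]; simp [portWord, back, portWord_append]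

variable {d : List (List ℕ) × List (List (ℕ × ℕ))}

theorem trans_rewrite {u : N.V} {l l' : List ℕ} {j : ℕ} (h : trace (label δ u) l = some j)
    (h' : trace (label δ u) l' = some j) (a : List (ℕ × ℕ)) (b : List ℕ) :
    Trans δ ((a, l ++ b), d) u ((a, l' ++ b), d) u :=
  Trans.of_execute (p := none) (3, l.length, l') (by simp [execute, rewriteRight, h, h'])

theorem trans_moveRight {u v : N.V} (p : N.graph.Walk u v) (a : List (ℕ × ℕ)) (b : List ℕ) :
    Trans δ ((a, portWord δ p ++ b), d) u ((stack δ p a, b), d) v := by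
  induction p generalizing a with
  | nil => exact Trans.refl _ _
  | cons h p ih =>
    rename_i u v w
    have ht : trace (label δ u) [δ.port u v, δ.port v u] = some 0 :=
      trace_portWord δ (.cons h (.cons h.symm .nil)) (by simp [h]) (by simp [ballList])
    have hex : execute (1, δ.port v u, []) (label δ u)
        ((a, portWord δ (.cons h p) ++ b), d) =
        some (some (δ.port u v), (((δ.port u v, δ.port v u) :: a, portWord δ p ++ b), d)) := by
      simp [execute, moveRight, portWord, ht]
    have hd : dest δ u (some (δ.port u v)) = v := by simp [dest, neighborAt_port δ h]
    exact (hd ▸ Trans.of_execute _ hex).trans (ih _)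

theorem trans_moveLeft {u v : N.V} (p : N.graph.Walk u v) (a : List (ℕ × ℕ)) (b : List ℕ) :
    Trans δ ((stack δ p a, b), d) v ((a, portWord δ p ++ b), d) u := by
  induction p generalizing a with
  | nil => exact Trans.refl _ _
  | cons h p ih =>
    rename_i u v w
    have hex : execute (2, 0, []) (label δ v)
        (((δ.port u v, δ.port v u) :: a, portWord δ p ++ b), d) =
        some (some (δ.port v u), ((a, portWord δ (.cons h p) ++ b), d)) := by
      simp [execute, moveLeft, portWord]
    have hd : dest δ v (some (δ.port v u)) = u := by simp [dest, neighborAt_port δ h.symm]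
    have hstep := Trans.of_execute _ hex
    rw [hd] at hstep
    exact (ih _).trans hstep

/-- Backtracks and triangles at the start of the path lie in the ball of the current vertex, so the
rewriting test accepts them. For `cons` the agent crosses the edge, applies the homotopy there and
returns, which changes `a`. Both directions are proved together to cope with `symm`. -/
theorem Homotopic.trans_right {u v : N.V} {p q : N.graph.Walk u v} (h : Homotopic p q)
    (a : List (ℕ × ℕ)) (b : List ℕ) :
    Trans δ ((a, portWord δ p ++ b), d) u ((a, portWord δ q ++ b), d) u ∧
      Trans δ ((a, portWord δ q ++ b), d) u ((a, portWord δ p ++ b), d) u := by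
  induction h generalizing a with
  | refl p => exact ⟨Trans.refl _ _, Trans.refl _ _⟩
  | symm _ ih => exact (ih a).symm
  | trans _ _ ih₁ ih₂ => exact ⟨(ih₁ a).1.trans (ih₂ a).1, (ih₂ a).2.trans (ih₁ a).2⟩
  | cons h _ ih =>
    rename_i u v w p q _
    have key : ∀ p q : N.graph.Walk v w, (∀ a : List (ℕ × ℕ),
        Trans δ ((a, portWord δ p ++ b), d) v ((a, portWord δ q ++ b), d) v) →
        Trans δ ((a, portWord δ (.cons h p) ++ b), d) u
          ((a, portWord δ (.cons h q) ++ b), d) u := by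
      intro p q hpq
      exact ((trans_moveRight (.cons h .nil) a (portWord δ p ++ b)).trans (hpq _)).trans
        (trans_moveLeft (.cons h .nil) a (portWord δ q ++ b))
    exact ⟨key p q fun a => (ih a).1, key q p fun a => (ih a).2⟩
  | backtrack h p =>
    rename_i u v w
    have ht : trace (label δ u) [δ.port u v, δ.port v u] = some 0 :=
      trace_portWord δ (.cons h (.cons h.symm .nil)) (by simp [h]) (by simp [ballList])
    exact ⟨trans_rewrite ht (l' := []) rfl a (portWord δ p ++ b),
      trans_rewrite (l := []) rfl ht a (portWord δ p ++ b)⟩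
  | triangle h h' h'' p =>
    rename_i u v w t
    obtain ⟨j, hj⟩ := List.mem_iff_getElem?.1 ((mem_ballList δ).2 (Or.inr h''))
    have h1 : trace (label δ u) [δ.port u v, δ.port v w] = some j :=
      trace_portWord δ (.cons h (.cons h' .nil)) (by simp [h, h'']) hj
    have h2 : trace (label δ u) [δ.port u w] = some j :=
      trace_portWord δ (.cons h'' .nil) (by simp [h'']) hj
    exact ⟨trans_rewrite h1 h2 a (portWord δ p ++ b), trans_rewrite h2 h1 a (portWord δ p ++ b)⟩

/-- Go home along `p`, which turns the pending path into `p` followed by `q`; deform it to `r`; walk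
along `r`. -/
theorem trans_of_homotopic {v₀ x t : N.V} (p : N.graph.Walk v₀ x) (q : N.graph.Walk x t)
    (r : N.graph.Walk v₀ t) (h : Homotopic (p.append q) r) :
    Trans δ ((stack δ p [], portWord δ q), d) x ((stack δ r [], []), d) t := by
  have h1 := trans_moveLeft (δ := δ) (d := d) p [] (portWord δ q)
  have h2 := (h.trans_right (δ := δ) (d := d) [] []).1
  have h3 := trans_moveRight (δ := δ) (d := d) r [] []
  rw [portWord_append, List.append_nil] at h2
  exact (h1.trans h2).trans h3

variable (δ) in
/-- The path stack of the chosen representative of a homotopy class. -/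
noncomputable def repStack {v₀ : N.V} (c : Cover N.graph v₀) : List (ℕ × ℕ) :=
  stack δ (Quotient.out c.2) []

theorem exists_portWord_of_mem_headI {v₀ x : N.V} (p : N.graph.Walk v₀ x) {w : List ℕ}
    (hw : w ∈ (label δ x).headI.map fun o => portWord δ p ++ o.toList) :
    ∃ (t : N.V) (q : N.graph.Walk v₀ t), w = portWord δ q := by
  classical
  obtain ⟨o, ho, rfl⟩ := List.mem_map.1 hw
  have ho' : ∃ z ∈ ballList δ x, (if N.graph.Adj x z then some (δ.port x z) else none) = o := by
    simpa only [label, ballList, List.map_cons, List.headI_cons, List.mem_cons, List.mem_map,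
      exists_eq_or_imp, eq_comm (a := o)] using ho
  obtain ⟨z, -, hz⟩ := ho'
  split_ifs at hz with hadj
  · exact ⟨z, p.append (.cons hadj .nil), by simp [portWord_append, portWord, ← hz]⟩
  · exact ⟨x, p, by simp [← hz]⟩

theorem canHalt_of_accept {s : Attempt} {x : N.V} (hr : s.1.2 = [])
    (h : ∀ w ws, (examine (label δ x) s).1 = w :: ws →
      CanHalt δ ((s.1.1, back s.1.1 ++ w), (ws, (examine (label δ x) s).2)) x) :
    CanHalt δ s x := by
  cases he : (examine (label δ x) s).1 with
  | nil => exact CanHalt.of_execute (0, 0, []) (by simp [execute, accept, hr, he])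
  | cons w ws =>
    exact (Trans.of_execute (p := none) (0, 0, [])
      (by simp [execute, accept, hr, he])).canHalt (h w ws he)

variable (δ) in
/-- Some instructions make the explorer halt when the representatives of the classes in `seen`
have been examined and the paths in `todo` are still to be examined. -/
def Succeeds (v₀ : N.V) (todo : List (List ℕ)) (seen : List (Cover N.graph v₀)) : Prop :=
  ∀ (x t : N.V) (p : N.graph.Walk v₀ x) (q : N.graph.Walk x t),
    CanHalt δ ((stack δ p [], portWord δ q), (todo, seen.map (repStack δ))) x

/-- Before examining the target, the instructions replace its path by the representative of its
class. Either this path is already in `seen` and `todo` loses its head, or a new class joins `seen`,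
after which `todo` may be arbitrary. -/
theorem Succeeds.of_examine {v₀ : N.V} {todo : List (List ℕ)} {seen : List (Cover N.graph v₀)}
    (htodo : ∀ w ∈ todo, ∃ (t : N.V) (q : N.graph.Walk v₀ t), w = portWord δ q)
    (h₁ : ∀ w ws, todo = w :: ws → Succeeds δ v₀ ws seen)
    (h₂ : ∀ c ∉ seen, ∀ todo' : List (List ℕ),
      (∀ w ∈ todo', ∃ (t : N.V) (q : N.graph.Walk v₀ t), w = portWord δ q) →
        Succeeds δ v₀ todo' (c :: seen)) : Succeeds δ v₀ todo seen := by
  intro x t p q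
  let c : Cover N.graph v₀ := Cover.mk (p.append q)
  let r : N.graph.Walk v₀ t := Quotient.out c.2
  have hr : Homotopic (p.append q) r := (Quotient.exact (Quotient.out_eq c.2)).symm
  refine (trans_of_homotopic p q r hr).canHalt (canHalt_of_accept rfl fun w ws he => ?_)
  -- The new `right`, home along the reverse of `r` and then along `w`, must be shown to be the port
  -- word of a walk.
  simp only [back_stack]
  rw [show back [] = [] from rfl, List.append_nil]
  by_cases hmem : stack δ r [] ∈ seen.map (repStack δ)
  · have hex : examine (label δ t) ((stack δ r [], []), (todo, seen.map (repStack δ))) =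
        (todo, seen.map (repStack δ)) := if_pos (List.idxOf_lt_length_iff.2 hmem)
    rw [hex] at he ⊢
    obtain ⟨t', q', rfl⟩ := htodo w (by simp [show todo = w :: ws from he])
    rw [← portWord_append]
    exact h₁ _ ws he _ _ r _
  · have hex : examine (label δ t) ((stack δ r [], []), (todo, seen.map (repStack δ))) =
        ((label δ t).headI.map (fun o => forth (stack δ r []) ++ o.toList) ++ todo,
          (c :: seen).map (repStack δ)) :=
      if_neg fun hlt => hmem (List.idxOf_lt_length_iff.1 hlt)
    rw [hex] at he ⊢
    have hall : ∀ w' ∈ w :: ws, ∃ (t : N.V) (q : N.graph.Walk v₀ t), w' = portWord δ q := by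
      intro w' hw'
      rw [← he, List.mem_append, forth_stack] at hw'
      exact hw'.elim (exists_portWord_of_mem_headI r) (htodo w')
    obtain ⟨t', q', rfl⟩ := hall w List.mem_cons_self
    rw [← portWord_append]
    exact h₂ c (fun hc => hmem (List.mem_map_of_mem hc)) ws
      (fun w' hw' => hall w' (List.mem_cons_of_mem _ hw')) _ _ r _

/-- With suitable instructions, an attempt succeeds: every path is replaced by the representative
of its class, so the number of examined paths is bounded. -/
theorem succeeds_of_fintype {v₀ : N.V} [Fintype (Cover N.graph v₀)] (k : ℕ)
    (todo : List (List ℕ)) (seen : List (Cover N.graph v₀))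
    (htodo : ∀ w ∈ todo, ∃ (t : N.V) (q : N.graph.Walk v₀ t), w = portWord δ q)
    (hnodup : seen.Nodup) (hcard : Fintype.card (Cover N.graph v₀) ≤ seen.length + k) :
    Succeeds δ v₀ todo seen := by
  have hk : ∀ c ∉ seen, (c :: seen).Nodup ∧ seen.length + 1 ≤ Fintype.card (Cover N.graph v₀) :=
    fun c hc => ⟨List.nodup_cons.2 ⟨hc, hnodup⟩,
      (List.nodup_cons.2 ⟨hc, hnodup⟩).length_le_card⟩
  induction k generalizing todo seen with
  | zero =>
    have h₂ : ∀ c, c ∈ seen := fun c => by_contra fun hc => by have := (hk c hc).2; omega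
    induction todo with
    | nil => exact .of_examine htodo (by simp) fun c hc => (hc (h₂ c)).elim
    | cons w ws ih =>
      refine .of_examine htodo (fun w' ws' he => ?_) fun c hc => (hc (h₂ c)).elim
      obtain ⟨-, rfl⟩ := List.cons.inj he
      exact ih fun w hw => htodo w (List.mem_cons_of_mem _ hw)
  | succ k ihk =>
    have h₂ : ∀ c ∉ seen, ∀ todo' : List (List ℕ),
        (∀ w ∈ todo', ∃ (t : N.V) (q : N.graph.Walk v₀ t), w = portWord δ q) →
          Succeeds δ v₀ todo' (c :: seen) := by
      intro c hc todo' htodo'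
      refine ihk todo' (c :: seen) htodo' (hk c hc).1 (by simp; omega) fun c' hc' => ?_
      have := List.nodup_cons.2 ⟨hc', (hk c hc).1⟩
      exact ⟨this, this.length_le_card⟩
    induction todo with
    | nil => exact .of_examine htodo (by simp) h₂
    | cons w ws ih =>
      refine .of_examine htodo (fun w' ws' he => ?_) h₂
      obtain ⟨-, rfl⟩ := List.cons.inj he
      exact ih fun w hw => htodo w (List.mem_cons_of_mem _ hw)

theorem reach_of_retreat {v₀ x : N.V} {s : Attempt} (h : Sound δ v₀ Set.univ s x) (n : ℕ)
    (i : Option ℕ) :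
    ∃ i', Reach δ ⟨((n, []), s), x, i⟩ ⟨((n + 1, program (n + 1)), Attempt.init), v₀, i'⟩ := by
  obtain ⟨⟨left, right⟩, d⟩ := s
  induction left generalizing x right i with
  | nil =>
    obtain rfl : x = v₀ := h.left
    exact reach_of_step (p := none) rfl
  | cons e l ih =>
    obtain ⟨i', hi'⟩ := reach_of_step (δ := δ) (x := x) (i := i)
      (m := ((n, []), (e :: l, right), d)) rfl
    obtain ⟨i'', hi''⟩ := ih (right := e.1 :: right) i' h.moveLeft
    exact ⟨i'', Relation.ReflTransGen.trans hi' hi''⟩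

/-- Taking `S` to be everything voids the condition on visits; what is used is that `left` leads
back home, so every unsuccessful attempt ends there. -/
theorem halts_or_reach {v₀ x : N.V} {s : Attempt} (h : Sound δ v₀ Set.univ s x) (n : ℕ)
    (cs : List Instr) (i : Option ℕ) :
    HaltsFrom δ ⟨((n, cs), s), x, i⟩ ∨
    ∃ i', Reach δ ⟨((n, cs), s), x, i⟩ ⟨((n + 1, program (n + 1)), Attempt.init), v₀, i'⟩ := by
  induction cs generalizing s x i with
  | nil => exact Or.inr (reach_of_retreat h n i)
  | cons c cs ih =>
    rcases h.execute (Set.mem_univ x) c with ⟨he, -⟩ | ⟨p, s', he, hs⟩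
    · exact Or.inl (haltsFrom_of_step (by simp [explorerStep, he]))
    · obtain ⟨i', hi'⟩ := reach_of_step (δ := δ) (x := x) (i := i) (p := p)
        (m := ((n, c :: cs), s)) (m' := ((n, cs), s')) (by simp [explorerStep, he])
      rcases ih hs i' with h1 | ⟨i'', h1⟩
      · exact Or.inl (hi'.haltsFrom h1)
      · exact Or.inr ⟨i'', Relation.ReflTransGen.trans hi' h1⟩

theorem halts_explorer (δ : PortNumbering N) (v₀ : N.V) (h : Finite (Cover N.graph v₀)) :
    Halts explorer δ v₀ := by
  have := Fintype.ofFinite (Cover N.graph v₀)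
  obtain ⟨cs, hcs⟩ := succeeds_of_fintype (δ := δ) (v₀ := v₀) _ [] [] (by simp) (by simp)
    (le_add_of_nonneg_left (Nat.zero_le _)) _ _ .nil .nil
  -- Either some earlier attempt halts, or attempt `n` is started at the homebase.
  have key : ∀ n, HaltsFrom δ ⟨explorer.init, v₀, none⟩ ∨
      ∃ i, Reach δ ⟨explorer.init, v₀, none⟩ ⟨((n, program n), Attempt.init), v₀, i⟩ := by
    intro n
    induction n with
    | zero => exact Or.inr ⟨none, Relation.ReflTransGen.refl⟩
    | succ n ih =>
      rcases ih with h1 | ⟨i, h1⟩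
      · exact Or.inl h1
      · rcases halts_or_reach (Sound.init Set.univ) n (program n) i with h2 | ⟨i', h2⟩
        · exact Or.inl (Reach.haltsFrom h1 h2)
        · exact Or.inr ⟨i', Relation.ReflTransGen.trans h1 h2⟩
  -- The attempt whose number encodes `cs` executes exactly `cs`.
  rcases key (Encodable.encode cs) with h1 | ⟨i, h1⟩
  · exact h1.halts
  · refine (Reach.haltsFrom h1 ?_).halts
    have hp : program (Encodable.encode cs) = cs ++ [] := by
      simp [program, Denumerable.ofNat_encode]
    rw [hp]
    exact hcs _ _ _

end Completeness

theorem halts_explorer_of_mem_FNT (N : Network) (hN : N ∈ FNT) (δ : PortNumbering N) (v₀ : N.V) :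
    Halts explorer δ v₀ :=
  halts_explorer δ v₀ ((mem_FNT_iff v₀).1 hN)

end Binoculars


theorem mainTheorem2 :
    IsGreatest {F : Set Binoculars.Network | Binoculars.IsExplorableSet F} Binoculars.FNT ∧
      (∀ N : Binoculars.Network, Binoculars.IsExplorable N ↔ N ∈ Binoculars.FNT) ∧
      (∀ (N : Binoculars.Network) (δ : Binoculars.PortNumbering N),
        Binoculars.IsExplorableWith N δ ↔ N ∈ Binoculars.FNT) := by
  open Binoculars in
  refine ⟨⟨⟨explorer, isExplorationAlgorithm_explorer, halts_explorer_of_mem_FNT⟩, ?_⟩,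
    fun N => ⟨?_, fun hN => ⟨explorer, isExplorationAlgorithm_explorer,
      halts_explorer_of_mem_FNT N hN⟩⟩,
    fun N δ => ⟨?_, fun hN => ⟨explorer, isExplorationAlgorithm_explorer,
      halts_explorer_of_mem_FNT N hN δ⟩⟩⟩
  · rintro F ⟨A, hA, h⟩ N hN
    -- Halting for all port numberings says something only because there is at least one.
    obtain ⟨δ⟩ := PortNumbering.nonempty N
    exact mem_FNT_of_halts hA (h N hN δ)
  · rintro ⟨A, hA, h⟩
    obtain ⟨δ⟩ := PortNumbering.nonempty N
    exact mem_FNT_of_halts hA (h δ)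
  · rintro ⟨A, hA, h⟩
    exact mem_FNT_of_halts hA h
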